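/- Let $A\in\mathbb{R}^{n\times n}$ be invertible, let $V,W\in\mathbb{R}^{n\times m}$ have full rank $m$ with $\det(W^TAV)\neq 0$, and let $x_0\in\mathbb{R}^n$. Let $Y\in\mathbb{R}^{n\times(n-m)}$ have linearly independent columns with $W^TAY=0$. Put $$P_1=I-V(W^TAV)^{-1}W^TA,\qquad P_2=Y(Y^TY)^{-1}Y^T,\qquad \widetilde{x}(b)=x_0+V(W^TAV)^{-1}W^T(b-Ax_0)\quad(b\in\mathbb{R}^n).$$ For $\alpha,\beta>0$ let $\mathsf{IG}(\alpha,\beta)$ be the inverse-gamma distribution, with density $\frac{\beta^\alpha}{\Gamma(\alpha)}s^{-(\alpha+1)}e^{-\beta/s}$ on $s>0$. For $\nu>0$, $\mu\in\mathbb{R}^n$ and a positive semidefinite matrix $\Sigma=UDU^T$ of rank $r$ (with $U^TU=I_r$ and $D\in\mathbb{R}^{r\times r}$ diagonal, positive definite) let $\mathsf{St}_\nu(\mu,\Sigma)$ be the multivariate Student distribution on the affine subspace $\mu+\mathsf{Range}(\Sigma)$, whose density with respect to the $r$-dimensional Lebesgue measure on that subspace is $$\frac{\Gamma\left(\frac{\nu+r}{2}\right)}{\Gamma\left(\frac{\nu}{2}\right)\sqrt{(\pi\nu)^r\det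 D}}\left(1+\tfrac1\nu(x-\mu)^T\Sigma^\dagger(x-\mu)\right)^{-\frac{\nu+r}{2}},$$ where $\Sigma^\dagger$ is the Moore--Penrose inverse. Let $\alpha,\beta>0$ and $k\in\mathbb{N}$. Let $s$ be a random scale with prior $s\sim\mathsf{IG}(\alpha,\beta)$. Conditionally on $s$, let $x$ be normal with mean $x_0$ and covariance $VV^T+sP_2$, and let $X=(X_{\star 1},\dots,X_{\star k})\in\mathbb{R}^{n\times k}$ consist of $k$ independent observations, each with the conditional distribution of $P_1(x-x_0)$ given $s$, that are also independent of $x$ given $s$. Set $$\widetilde{\alpha}=\alpha+\frac{k(n-m)}{2},\qquad \widetilde{\beta}=\beta+\frac{\mathrm{tr}(X^TX)}{2}.$$ Then: 1. The posterior distribution of $s$ given $X$ is $\mathsf{IG}(\widetilde{\alpha},\widetilde{\beta})$. 2. The predictive distribution of $x$ given $W^TAx=W^Tb$ and $X$ is $\mathsf{St}_{2\widetilde{\alpha}}\left(\widetilde{x}(b),\frac{\widetilde{\beta}}{\widetilde{\alpha}}P_2\right)$. Both assertions hold for the regular conditional distributions, for almost every value of the data. They also hold for every single $b\in\mathbb{R}^n$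 and every value of $X$ with columns in $\mathsf{Range}(P_1)$, in the following sense: every ball around the given value of the data has positive probability, and the conditional law given that the data lie in the ball of radius $\varepsilon$ around that value converges weakly to the stated distribution as $\varepsilon\downarrow0$. -/

import Mathlib

open MeasureTheory ProbabilityTheory Filter Topology
open scoped ENNReal Matrix BoundedContinuousFunction

namespace ProjUQ

noncomputable section

/-- Density of the inverse-gamma distribution `IG(α, β)` (shape `α`, scale `β`). -/
def invGammaPDFReal (α β s : ℝ) : ℝ :=
  if 0 < s then β ^ α / Real.Gamma α * s ^ (-(α + 1)) * Real.exp (-β / s) else 0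

/-- The inverse-gamma distribution `IG(α, β)` on `ℝ`. -/
def invGamma (α β : ℝ) : Measure ℝ :=
  volume.withDensity fun s => ENNReal.ofReal (invGammaPDFReal α β s)

/-- Moore-Penrose inverse of a symmetric matrix: the nonzero eigenvalues are inverted
(recall `0⁻¹ = 0`), the eigenvectors are kept. -/
def symmPinv {n : ℕ} (S : Matrix (Fin n) (Fin n) ℝ) : Matrix (Fin n) (Fin n) ℝ :=
  cfc (fun t : ℝ => t⁻¹) S

/-- Product of the nonzero eigenvalues (with multiplicity) of a symmetric matrix, that is `det D`
for `S = U D Uᵀ` with `Uᵀ U = 1` and `D` diagonal and invertible. -/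
def pseudoDet {n : ℕ} (S : Matrix (Fin n) (Fin n) ℝ) : ℝ :=
  (S.charpoly.roots.filter (fun t => t ≠ 0)).prod

/-- Density of the multivariate Student distribution `St_ν(μ, S)`, `S` positive semidefinite of
rank `k`, with respect to the `k`-dimensional Lebesgue measure on `μ + Range S`. -/
def studentPDFReal {n : ℕ} (ν : ℝ) (μ : EuclideanSpace ℝ (Fin n))
    (S : Matrix (Fin n) (Fin n) ℝ) (x : EuclideanSpace ℝ (Fin n)) : ℝ :=
  Real.Gamma ((ν + S.rank) / 2) /
      (Real.Gamma (ν / 2) * √((Real.pi * ν) ^ S.rank * pseudoDet S)) /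
    (1 + 1 / ν * inner ℝ (x - μ) (Matrix.toEuclideanLin (symmPinv S) (x - μ))) ^
      ((ν + S.rank) / 2)

/-- The (possibly degenerate) multivariate Student distribution `St_ν(μ, S)`, carried by the
affine subspace `μ + Range S`. The measure `volume` on the subspace `Range S` is the Lebesgue
measure of its Euclidean structure. -/
def multivariateStudent {n : ℕ} (ν : ℝ) (μ : EuclideanSpace ℝ (Fin n))
    (S : Matrix (Fin n) (Fin n) ℝ) : Measure (EuclideanSpace ℝ (Fin n)) :=
  ((@volume (LinearMap.range (Matrix.toEuclideanLin S)) measureSpaceOfInnerProductSpace).withDensity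
      fun t => ENNReal.ofReal (studentPDFReal ν μ S (μ + (t : EuclideanSpace ℝ (Fin n))))).map
    fun t : LinearMap.range (Matrix.toEuclideanLin S) => μ + (t : EuclideanSpace ℝ (Fin n))

/-- The approximate solution `x̃ = x₀ + V (Wᵀ A V)⁻¹ Wᵀ (b - A x₀)` of a projection method. -/
def projApprox {n m : ℕ} (A : Matrix (Fin n) (Fin n) ℝ) (V W : Matrix (Fin n) (Fin m) ℝ)
    (x₀ b : EuclideanSpace ℝ (Fin n)) : EuclideanSpace ℝ (Fin n) :=
  x₀ + Matrix.toEuclideanLin (V * (Wᵀ * A * V)⁻¹ * Wᵀ) (b - Matrix.toEuclideanLin A x₀)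

/-- `P₁ = I - V (Wᵀ A V)⁻¹ Wᵀ A`. -/
def projP₁ {n m : ℕ} (A : Matrix (Fin n) (Fin n) ℝ) (V W : Matrix (Fin n) (Fin m) ℝ) :
    Matrix (Fin n) (Fin n) ℝ :=
  1 - V * (Wᵀ * A * V)⁻¹ * Wᵀ * A

/-- `P₂ = Y (Yᵀ Y)⁻¹ Yᵀ`. -/
def projP₂ {n l : ℕ} (Y : Matrix (Fin n) (Fin l) ℝ) : Matrix (Fin n) (Fin n) ℝ :=
  Y * (Yᵀ * Y)⁻¹ * Yᵀ

/-- The `n × k` matrix whose columns are the given vectors. -/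
def colMatrix {n k : ℕ} (X : Fin k → EuclideanSpace ℝ (Fin n)) : Matrix (Fin n) (Fin k) ℝ :=
  Matrix.of fun i j => X j i

/-- `α̃ = α + k (n - m) / 2`. -/
def postShape (n m k : ℕ) (α : ℝ) : ℝ :=
  α + k * ((n : ℝ) - m) / 2

/-- `β̃ = β + tr (Xᵀ X) / 2`. -/
def postScale {n k : ℕ} (β : ℝ) (X : Fin k → EuclideanSpace ℝ (Fin n)) : ℝ :=
  β + ((colMatrix X)ᵀ * colMatrix X).trace / 2

/-- Conditioning on the single (possibly null) event `D = d`: every ball around `d` has positive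
probability under the law of `D`, and the law of `Z` given that `D` lies in the ball of radius `ε`
around `d` converges weakly to `ν` as `ε` decreases to `0`. -/
def HasCondLawAt {Ω F T : Type*} [MeasurableSpace Ω] [TopologicalSpace F] [MeasurableSpace F]
    [PseudoMetricSpace T] (P : Measure Ω) (Z : Ω → F) (D : Ω → T) (d : T) (ν : Measure F) : Prop :=
  (∀ ε : ℝ, 0 < ε → P (D ⁻¹' Metric.ball d ε) ≠ 0) ∧
    ∀ f : F →ᵇ ℝ,
      Tendsto (fun ε : ℝ => ∫ ω, f (Z ω) ∂(ProbabilityTheory.cond P (D ⁻¹' Metric.ball d ε)))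
        (𝓝[>] 0) (𝓝 (∫ z, f z ∂ν))

end

end ProjUQ

/-! Orthonormalizing the columns of `Y` gives `Q` with `Qᵀ Q = 1` and `Q Qᵀ = P₂`. Given `s = r`,
the unknown has the law of `x₀ + V z + √r Q w` with independent standard Gaussian `z`, `w`
(`multivariateGaussian_eq_map`). Since `P₁ V = 0` and `P₁ Q = Q`, each observation has the law of
`√r Q w'`, so in the coordinates of `Q` the data `X` form an isotropic Gaussian vector of variance
`r` in dimension `k (n - m)`.

The inverse-gamma prior is conjugate to this family: prior times likelihood equals a marginal
density (`evidence`) times the updated inverse-gamma density. Tonelli turns this into a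
disintegration of the joint law along `X` (`lintegral_model`), which is the posterior of `s`.

For the prediction, `Wᵀ A Q = 0` and `Wᵀ A V` is invertible, so `Wᵀ A x` is equivalent to knowing
`z` and says nothing about `r`, `w` or `X`. Given the data there remains `x̃(b) + √r Q w` with `r`
distributed as the posterior. Such a scale mixture is Student: the same conjugacy identity, now in
dimension `n - m`, has the Student density as its `evidence` (`multivariateStudent_eq_map`).

For single values of the data, all fibre laws are images of one fixed probability measure under maps
continuous in the data. They are therefore weakly continuous, and conditioning on a small ball
averages nearby fibre laws. Balls have positive probability because the data are a continuous image
of a law charging every nonempty open set, and every admissible value is attained because `Range P₁`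
lies in `Range Q`. -/

namespace ProjUQ

/-! ### Measures with densities: products, dilations, positivity on open sets. -/

section Densities

/-- A finite product of measures with integrable densities has the product density. -/
theorem pi_withDensity_ofReal {ι : Type*} [Fintype ι] {E : ι → Type*}
    [∀ i, MeasurableSpace (E i)] (μ : ∀ i, Measure (E i)) [∀ i, SigmaFinite (μ i)]
    (f : ∀ i, E i → ℝ) (hf : ∀ i, Integrable (f i) (μ i)) (hf0 : ∀ i x, 0 ≤ f i x) :
    Measure.pi (fun i => (μ i).withDensity fun x => ENNReal.ofReal (f i x)) =
      (Measure.pi μ).withDensity fun x => ENNReal.ofReal (∏ i, f i (x i)) := by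
  have hfin : ∀ i, IsFiniteMeasure ((μ i).withDensity fun x => ENNReal.ofReal (f i x)) := fun i =>
    isFiniteMeasure_withDensity_ofReal (hf i).2
  refine Measure.pi_eq fun s hs => ?_
  rw [withDensity_apply _ (MeasurableSet.univ_pi hs), Measure.restrict_pi_pi,
    ← ofReal_integral_eq_lintegral_ofReal, integral_fintype_prod_eq_prod,
    ENNReal.ofReal_prod_of_nonneg]
  · refine Finset.prod_congr rfl fun i _ => ?_
    rw [withDensity_apply _ (hs i), ofReal_integral_eq_lintegral_ofReal (hf i).restrict
      (ae_of_all _ (hf0 i))]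
  · exact fun i _ => integral_nonneg (hf0 i)
  · exact Integrable.fintype_prod_dep fun i => (hf i).restrict
  · exact ae_of_all _ fun x => Finset.prod_nonneg fun i _ => hf0 i _

/-- The density of the image of a measure with a density under a homothety. -/
theorem map_smul_withDensity {E : Type*} [NormedAddCommGroup E] [NormedSpace ℝ E]
    [MeasurableSpace E] [BorelSpace E] [FiniteDimensional ℝ E] (μ : Measure E) [μ.IsAddHaarMeasure]
    {p : E → ℝ≥0∞} (hp : Measurable p) {c : ℝ} (hc : c ≠ 0) :
    (μ.withDensity p).map (fun x => c • x) =
      μ.withDensity fun x => ENNReal.ofReal |(c ^ Module.finrank ℝ E)⁻¹| * p (c⁻¹ • x) := by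
  have hm : Measurable fun x : E => c • x := measurable_const_smul c
  have hp' : Measurable fun x : E => p (c⁻¹ • x) := hp.comp (measurable_const_smul c⁻¹)
  ext s hs
  rw [Measure.map_apply hm hs, withDensity_apply _ (hm hs), withDensity_apply _ hs,
    lintegral_const_mul _ hp', ← lintegral_indicator (hm hs), ← lintegral_indicator hs,
    ← smul_eq_mul, ← lintegral_smul_measure, ← Measure.map_addHaar_smul μ hc,
    lintegral_map (hp'.indicator hs) hm]
  refine lintegral_congr fun x => ?_
  simp only [Set.indicator, inv_smul_smul₀ hc]
  rfl

theorem isOpenPosMeasure_withDensity {E : Type*} [TopologicalSpace E] [MeasurableSpace E]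
    (μ : Measure E) [μ.IsOpenPosMeasure] {p : E → ℝ≥0∞} (hp : Measurable p) (hp0 : ∀ x, p x ≠ 0) :
    (μ.withDensity p).IsOpenPosMeasure :=
  (withDensity_absolutelyContinuous' hp.aemeasurable (ae_of_all _ hp0)).isOpenPosMeasure

end Densities

/-! ### From weakly continuous disintegrations to conditioning on single points. -/

section ConditionalLaw

variable {Ω F T : Type*} [MeasurableSpace Ω] [TopologicalSpace F] [MeasurableSpace F]
  [BorelSpace F] [PseudoMetricSpace T] [MeasurableSpace T] [OpensMeasurableSpace T]

/-- A disintegration along `D` whose fibre laws depend weakly continuously on the value of `D`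
gives the conditional laws at the single points of the support of `D`. -/
theorem hasCondLawAt_of_map_eq_compProd {P : Measure Ω} [IsProbabilityMeasure P] {Z : Ω → F}
    {D : Ω → T} (hZ : Measurable Z) (hD : Measurable D) (κ : Kernel T F) [IsMarkovKernel κ]
    (hκ : P.map (fun ω => (D ω, Z ω)) = P.map D ⊗ₘ κ) {d : T}
    (hcont : ∀ f : F →ᵇ ℝ, ContinuousAt (fun t => ∫ z, f z ∂(κ t)) d)
    (hpos : ∀ ε : ℝ, 0 < ε → P (D ⁻¹' Metric.ball d ε) ≠ 0) :
    HasCondLawAt P Z D d (κ d) := by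
  refine ⟨hpos, fun f => ?_⟩
  have hfm : Measurable f := f.continuous.measurable
  have hint : ∀ t, ‖∫ z, f z ∂(κ t)‖ ≤ ‖f‖ := fun t => by
    simpa using norm_integral_le_of_norm_le_const (μ := κ t) (ae_of_all _ f.norm_coe_le_norm)
  have hgm : StronglyMeasurable fun t => ∫ z, f z ∂(κ t) :=
    StronglyMeasurable.integral_kernel hfm.stronglyMeasurable
  -- Over a ball, the disintegration replaces `f (Z ω)` by its fibre average; the normalizing factor
  -- is the same on both sides.
  have key : ∀ ε : ℝ, 0 < ε →
      ∫ ω, f (Z ω) ∂(ProbabilityTheory.cond P (D ⁻¹' Metric.ball d ε)) =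
        ∫ ω, (∫ z, f z ∂(κ (D ω))) ∂(ProbabilityTheory.cond P (D ⁻¹' Metric.ball d ε)) := by
    intro ε hε
    have hB : MeasurableSet (Metric.ball d ε) := Metric.isOpen_ball.measurableSet
    simp only [ProbabilityTheory.cond, integral_smul_measure]
    congr 1
    have h1 : ∫ ω in D ⁻¹' Metric.ball d ε, f (Z ω) ∂P =
        ∫ q in Metric.ball d ε ×ˢ Set.univ, f q.2 ∂(P.map fun ω => (D ω, Z ω)) := by
      rw [setIntegral_map (f := fun q : T × F => f q.2) (hB.prod MeasurableSet.univ)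
        (hfm.comp measurable_snd).aestronglyMeasurable (hD.prodMk hZ).aemeasurable]
      congr 2
      ext ω
      simp
    have h2 : ∫ ω in D ⁻¹' Metric.ball d ε, (∫ z, f z ∂(κ (D ω))) ∂P =
        ∫ t in Metric.ball d ε, (∫ z, f z ∂(κ t)) ∂(P.map D) := by
      rw [setIntegral_map hB hgm.aestronglyMeasurable hD.aemeasurable]
    have : IsProbabilityMeasure (P.map D) := Measure.isProbabilityMeasure_map hD.aemeasurable
    rw [h1, h2, hκ, Measure.setIntegral_compProd hB MeasurableSet.univ]
    · simp
    · exact (Integrable.of_bound (C := ‖f‖) (hfm.comp measurable_snd).aestronglyMeasurable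
        (ae_of_all _ fun q => f.norm_coe_le_norm _)).integrableOn
  rw [Metric.tendsto_nhdsWithin_nhds]
  intro η hη
  obtain ⟨δ, hδ, hball⟩ := Metric.continuousAt_iff.1 (hcont f) (η / 2) (half_pos hη)
  refine ⟨δ, hδ, fun {ε} hε0 hεδ => ?_⟩
  have hε : 0 < ε := hε0
  have hεδ' : ε < δ := by simpa [Real.dist_eq, abs_of_pos hε] using hεδ
  rw [key ε hε]
  have hB : MeasurableSet (D ⁻¹' Metric.ball d ε) := hD Metric.isOpen_ball.measurableSet
  have : IsProbabilityMeasure (ProbabilityTheory.cond P (D ⁻¹' Metric.ball d ε)) :=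
    cond_isProbabilityMeasure (hpos ε hε)
  have hI : Integrable (fun ω => ∫ z, f z ∂(κ (D ω)))
      (ProbabilityTheory.cond P (D ⁻¹' Metric.ball d ε)) :=
    Integrable.of_bound (C := ‖f‖) (hgm.comp_measurable hD).aestronglyMeasurable
      (ae_of_all _ fun ω => hint _)
  -- The conditioned measure puts `D` within `δ` of `d` almost surely, so the averaged integrand
  -- differs from its value at `d` by at most `η / 2`.
  have hle : ‖∫ ω, ((∫ z, f z ∂(κ (D ω))) - ∫ z, f z ∂(κ d))
      ∂(ProbabilityTheory.cond P (D ⁻¹' Metric.ball d ε))‖ ≤ η / 2 := by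
    have := norm_integral_le_of_norm_le_const
      (μ := ProbabilityTheory.cond P (D ⁻¹' Metric.ball d ε)) (C := η / 2)
      (f := fun ω => (∫ z, f z ∂(κ (D ω))) - ∫ z, f z ∂(κ d)) ?_
    · simpa using this
    · filter_upwards [ae_cond_mem hB] with ω hω
      have hω' : dist (D ω) d < ε := hω
      exact (hball (hω'.trans hεδ')).le
  rw [integral_sub hI (integrable_const _)] at hle
  simp only [integral_const, probReal_univ, one_smul] at hle
  rw [dist_eq_norm]
  linarith

/-- A Markov kernel leaves the first marginal unchanged, so `ρ` is forced to be the law of `D` and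
need not be computed separately. -/
theorem map_prodMk_eq_compProd {F T : Type*} [MeasurableSpace F] [MeasurableSpace T]
    {P : Measure Ω} {Z : Ω → F} {D : Ω → T} (hZ : Measurable Z)
    (κ : Kernel T F) [IsMarkovKernel κ] (ρ : Measure T) [SFinite ρ]
    (h : P.map (fun ω => (D ω, Z ω)) = ρ ⊗ₘ κ) :
    P.map D = ρ ∧ P.map (fun ω => (D ω, Z ω)) = P.map D ⊗ₘ κ := by
  have h1 : P.map D = ρ := by
    rw [← Measure.fst_compProd ρ κ, ← h, Measure.fst_map_prodMk hZ]
  exact ⟨h1, by rw [h1, h]⟩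

end ConditionalLaw

/-! ### The inverse-gamma law and its conjugacy to Gaussian scales. -/

section InverseGamma

theorem invGammaPDFReal_nonneg {α β : ℝ} (hα : 0 < α) (hβ : 0 < β) (s : ℝ) :
    0 ≤ invGammaPDFReal α β s := by
  unfold invGammaPDFReal
  have := Real.Gamma_pos_of_pos hα
  split_ifs <;> positivity

theorem measurable_invGammaPDFReal (α β : ℝ) : Measurable (invGammaPDFReal α β) :=
  Measurable.ite measurableSet_Ioi (by fun_prop) measurable_const

/-- The substitution `t = s⁻¹` turns the total mass into Euler's Gamma integral. -/
theorem isProbabilityMeasure_invGamma {α β : ℝ} (hα : 0 < α) (hβ : 0 < β) :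
    IsProbabilityMeasure (invGamma α β) := by
  have hΓ := Real.Gamma_pos_of_pos hα
  constructor
  rw [invGamma, withDensity_apply _ MeasurableSet.univ, Measure.restrict_univ]
  let g : ℝ → ℝ := fun t => β ^ α / Real.Gamma α * (t ^ (α - 1) * Real.exp (-(β * t)))
  have hg : IntegrableOn g (Set.Ioi 0) := by
    refine Integrable.const_mul ?_ _
    -- A non-integrable function has Bochner integral `0`, whereas the Gamma integral is positive.
    by_contra h
    have h1 := Real.integral_rpow_mul_exp_neg_mul_Ioi hα hβ
    rw [integral_undef h] at h1
    have : 0 < (1 / β) ^ α * Real.Gamma α := by positivity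
    exact this.ne h1
  have hgI : ∫ t in Set.Ioi 0, g t = 1 := by
    simp only [g]
    rw [integral_const_mul, Real.integral_rpow_mul_exp_neg_mul_Ioi hα hβ, one_div,
      Real.inv_rpow hβ.le]
    have : β ^ α ≠ 0 := (Real.rpow_pos_of_pos hβ α).ne'
    field_simp
  have hcongr : ∀ s ∈ Set.Ioi (0 : ℝ),
      (|(-1 : ℝ)| * s ^ ((-1 : ℝ) - 1)) • g (s ^ (-1 : ℝ)) = invGammaPDFReal α β s := by
    intro s hs
    have hs : 0 < s := hs
    simp only [g, invGammaPDFReal, hs, if_true, smul_eq_mul, abs_neg, abs_one, one_mul]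
    rw [← Real.rpow_mul hs.le, Real.rpow_neg_one, neg_div, div_eq_mul_inv β s,
      show (-(α + 1)) = (-1 - 1) + (-1 * (α - 1)) by ring, Real.rpow_add hs]
    ring
  have hint : IntegrableOn (invGammaPDFReal α β) (Set.Ioi 0) :=
    ((integrableOn_Ioi_comp_rpow_iff g (by norm_num : (-1 : ℝ) ≠ 0)).2 hg).congr_fun hcongr
      measurableSet_Ioi
  have hI : ∫ s in Set.Ioi 0, invGammaPDFReal α β s = 1 := by
    rw [← setIntegral_congr_fun measurableSet_Ioi hcongr,
      integral_comp_rpow_Ioi g (by norm_num : (-1 : ℝ) ≠ 0), hgI]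
  have hsupp : ∫⁻ s, ENNReal.ofReal (invGammaPDFReal α β s) =
      ∫⁻ s in Set.Ioi 0, ENNReal.ofReal (invGammaPDFReal α β s) := by
    rw [← lintegral_indicator measurableSet_Ioi]
    refine lintegral_congr fun s => ?_
    by_cases hs : 0 < s <;> simp [invGammaPDFReal, hs]
  rw [hsupp, ← ofReal_integral_eq_lintegral_ofReal hint
    (ae_of_all _ (invGammaPDFReal_nonneg hα hβ)), hI, ENNReal.ofReal_one]

theorem invGamma_ae_pos (α β : ℝ) : ∀ᵐ s ∂(invGamma α β), 0 < s := by
  rw [invGamma, ae_withDensity_iff (measurable_invGammaPDFReal α β).ennreal_ofReal]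
  refine ae_of_all _ fun s hs => ?_
  by_contra h
  simp [invGammaPDFReal, h] at hs

/-- The scale parameter of the inverse-gamma distribution. -/
theorem map_mul_invGamma_one {α β : ℝ} (hβ : 0 < β) :
    (invGamma α 1).map (fun s => β * s) = invGamma α β := by
  have h := map_smul_withDensity (volume : Measure ℝ)
    (measurable_invGammaPDFReal α 1).ennreal_ofReal hβ.ne'
  simp only [smul_eq_mul] at h
  rw [invGamma, h, invGamma]
  congr 1
  ext s
  rw [← ENNReal.ofReal_mul (abs_nonneg _)]
  congr 1
  have hiff : 0 < β⁻¹ * s ↔ 0 < s := by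
    constructor
    · intro h; simpa [hβ.ne'] using mul_pos hβ h
    · intro h; positivity
  by_cases hs : 0 < s
  · simp only [invGammaPDFReal, hiff, hs, if_true, Module.finrank_self, pow_one, abs_inv,
      abs_of_pos hβ, Real.one_rpow]
    rw [Real.mul_rpow (by positivity) hs.le, Real.inv_rpow hβ.le, Real.rpow_neg hβ.le, inv_inv,
      Real.rpow_add_one hβ.ne', show -1 / (β⁻¹ * s) = -β / s by field_simp]
    field_simp
  · simp [invGammaPDFReal, hiff, hs]

/-- The marginal density at a point of squared norm `q` of an isotropic Gaussian vector in
dimension `d` whose variance is distributed as `IG(α, β)`. -/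
noncomputable def evidence (α β d q : ℝ) : ℝ :=
  (2 * Real.pi) ^ (-(d / 2)) * (β ^ α / Real.Gamma α) *
    (Real.Gamma (α + d / 2) / (β + q / 2) ^ (α + d / 2))

theorem evidence_pos {α β d q : ℝ} (hα : 0 < α) (hβ : 0 < β) (hd : 0 ≤ d) (hq : 0 ≤ q) :
    0 < evidence α β d q := by
  have h1 := Real.Gamma_pos_of_pos hα
  have h2 : 0 < Real.Gamma (α + d / 2) := Real.Gamma_pos_of_pos (by positivity)
  unfold evidence
  have := Real.pi_pos
  positivity

/-- Conjugacy: the powers of `r` combine, and so do the exponents `-β / r` and `-q / (2 r)`, which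
leaves an unnormalized inverse-gamma density. `evidence` collects the normalizing constants. -/
theorem invGammaPDFReal_mul_gaussian {α β d q r : ℝ} (hα : 0 < α) (hβ : 0 < β) (hd : 0 ≤ d)
    (hq : 0 ≤ q) (hr : 0 < r) :
    invGammaPDFReal α β r * ((2 * Real.pi * r) ^ (-(d / 2)) * Real.exp (-q / (2 * r))) =
      evidence α β d q * invGammaPDFReal (α + d / 2) (β + q / 2) r := by
  have h2 : 0 < Real.Gamma (α + d / 2) := Real.Gamma_pos_of_pos (by positivity)
  have h3 : 0 < β + q / 2 := by positivity
  have h4 : 0 < (β + q / 2) ^ (α + d / 2) := Real.rpow_pos_of_pos h3 _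
  have hpi := Real.pi_pos
  simp only [invGammaPDFReal, hr, if_true, evidence]
  rw [Real.mul_rpow (by positivity) hr.le,
    show -(β + q / 2) / r = -β / r + -q / (2 * r) by field_simp; ring, Real.exp_add,
    show -(α + d / 2 + 1) = -(α + 1) + -(d / 2) by ring, Real.rpow_add hr]
  field_simp

/-- Bayes' formula for the scale of a Gaussian family with inverse-gamma prior. -/
theorem lintegral_invGamma_gaussian {U : Type*} [MeasurableSpace U] (lam : Measure U)
    [SFinite lam] {N : U → ℝ} (hN : Measurable N) (hN0 : ∀ u, 0 ≤ N u) {α β d : ℝ} (hα : 0 < α)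
    (hβ : 0 < β) (hd : 0 ≤ d) (G : ℝ → Measure U)
    (hG : ∀ r, 0 < r → G r = lam.withDensity fun u => ENNReal.ofReal
      ((2 * Real.pi * r) ^ (-(d / 2)) * Real.exp (-N u / (2 * r))))
    {f : ℝ → U → ℝ≥0∞} (hf : Measurable (Function.uncurry f)) :
    ∫⁻ r, ∫⁻ u, f r u ∂(G r) ∂(invGamma α β) =
      ∫⁻ u, ENNReal.ofReal (evidence α β d (N u)) *
        ∫⁻ r, f r u ∂(invGamma (α + d / 2) (β + N u / 2)) ∂lam := by
  have hp := (measurable_invGammaPDFReal α β).ennreal_ofReal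
  have hf1 : ∀ r, Measurable (f r) := fun r => hf.comp measurable_prodMk_left
  have hf2 : ∀ u, Measurable fun r => f r u := fun u => hf.comp measurable_prodMk_right
  have hL : ∀ r, 0 < r → ∫⁻ u, f r u ∂(G r) = ∫⁻ u, ENNReal.ofReal
      ((2 * Real.pi * r) ^ (-(d / 2)) * Real.exp (-N u / (2 * r))) * f r u ∂lam := by
    intro r hr
    rw [hG r hr, lintegral_withDensity_eq_lintegral_mul₀ _ (hf1 r).aemeasurable]
    · rfl
    · fun_prop
  have h1 : ∫⁻ r, ∫⁻ u, f r u ∂(G r) ∂(invGamma α β) =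
      ∫⁻ r, ∫⁻ u, ENNReal.ofReal ((2 * Real.pi * r) ^ (-(d / 2)) * Real.exp (-N u / (2 * r))) *
        f r u ∂lam ∂(invGamma α β) := by
    refine lintegral_congr_ae ?_
    filter_upwards [invGamma_ae_pos α β] with r hr using hL r hr
  have hm : Measurable (Function.uncurry fun (r : ℝ) (u : U) =>
      ENNReal.ofReal ((2 * Real.pi * r) ^ (-(d / 2)) * Real.exp (-N u / (2 * r))) * f r u) := by
    refine Measurable.mul ?_ hf
    fun_prop
  rw [h1, invGamma, lintegral_withDensity_eq_lintegral_mul₀ hp.aemeasurable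
    hm.lintegral_prod_right.aemeasurable]
  simp only [Pi.mul_apply]
  have h2 : ∀ r, ENNReal.ofReal (invGammaPDFReal α β r) * ∫⁻ u,
      ENNReal.ofReal ((2 * Real.pi * r) ^ (-(d / 2)) * Real.exp (-N u / (2 * r))) * f r u ∂lam =
      ∫⁻ u, ENNReal.ofReal (evidence α β d (N u)) *
        (ENNReal.ofReal (invGammaPDFReal (α + d / 2) (β + N u / 2) r) * f r u) ∂lam := by
    intro r
    have hmr : Measurable fun u => ENNReal.ofReal
        ((2 * Real.pi * r) ^ (-(d / 2)) * Real.exp (-N u / (2 * r))) * f r u :=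
      Measurable.mul (by fun_prop) (hf1 r)
    rw [← lintegral_const_mul _ hmr]
    refine lintegral_congr fun u => ?_
    rw [← mul_assoc, ← mul_assoc, ← ENNReal.ofReal_mul (invGammaPDFReal_nonneg hα hβ r),
      ← ENNReal.ofReal_mul (evidence_pos hα hβ hd (hN0 u)).le]
    by_cases hr : 0 < r
    · rw [invGammaPDFReal_mul_gaussian hα hβ hd (hN0 u) hr]
    · simp [invGammaPDFReal, hr]
  simp_rw [h2]
  -- Tonelli: the scale becomes the inner variable, as it has to be for a posterior.
  rw [lintegral_lintegral_swap]
  · refine lintegral_congr fun u => ?_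
    have hp' := (measurable_invGammaPDFReal (α + d / 2) (β + N u / 2)).ennreal_ofReal
    have hmu : Measurable fun r =>
        ENNReal.ofReal (invGammaPDFReal (α + d / 2) (β + N u / 2) r) * f r u := hp'.mul (hf2 u)
    rw [lintegral_const_mul _ hmu, invGamma,
      lintegral_withDensity_eq_lintegral_mul₀ hp'.aemeasurable (hf2 u).aemeasurable]
    rfl
  · refine Measurable.aemeasurable ?_
    simp only [Function.uncurry_def, evidence, invGammaPDFReal]
    refine Measurable.mul (by fun_prop) (Measurable.mul (Measurable.ennreal_ofReal
      (Measurable.ite (measurableSet_lt measurable_const measurable_fst) (by fun_prop)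
        measurable_const)) hf)

end InverseGamma

/-! ### Densities of standard Gaussian vectors and their dilations. -/

section GaussianDensity

theorem stdGaussian_eq_withDensity (l : ℕ) :
    stdGaussian (EuclideanSpace ℝ (Fin l)) = volume.withDensity fun x => ENNReal.ofReal
      ((2 * Real.pi) ^ (-((l : ℝ) / 2)) * Real.exp (-‖x‖ ^ 2 / 2)) := by
  have hpi := Real.pi_pos
  have hint : Integrable (gaussianPDFReal 0 1) := integrable_gaussianPDFReal 0 1
  have h1 : (Measure.pi fun _ : Fin l => gaussianReal 0 1) =
      volume.withDensity fun x : Fin l → ℝ => ENNReal.ofReal (∏ i, gaussianPDFReal 0 1 (x i)) := by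
    rw [gaussianReal_of_var_ne_zero 0 one_ne_zero]
    exact pi_withDensity_ofReal (fun _ : Fin l => (volume : Measure ℝ)) _ (fun _ => hint)
      fun _ => gaussianPDFReal_nonneg 0 1
  have hmp := PiLp.volume_preserving_toLp (Fin l)
  rw [← map_pi_eq_stdGaussian, h1]
  ext s hs
  rw [Measure.map_apply hmp.measurable hs, withDensity_apply _ (hmp.measurable hs),
    withDensity_apply _ hs, ← hmp.setLIntegral_comp_preimage hs (by fun_prop)]
  refine setLIntegral_congr_fun (hmp.measurable hs) fun x _ => ?_
  congr 1
  simp only [gaussianPDFReal, sub_zero, NNReal.coe_one, mul_one]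
  rw [Finset.prod_mul_distrib, ← Real.exp_sum, Finset.prod_const, Finset.card_univ,
    Fintype.card_fin, EuclideanSpace.real_norm_sq_eq, ← Finset.sum_div, Finset.sum_neg_distrib]
  congr 1
  rw [Real.sqrt_eq_rpow, ← Real.rpow_neg (by positivity), ← Real.rpow_mul_natCast (by positivity)]
  congr 1
  ring

theorem integrable_stdGaussian_density (l : ℕ) :
    Integrable fun x : EuclideanSpace ℝ (Fin l) =>
      (2 * Real.pi) ^ (-((l : ℝ) / 2)) * Real.exp (-‖x‖ ^ 2 / 2) := by
  have hpi := Real.pi_pos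
  refine ⟨by fun_prop, ?_⟩
  rw [hasFiniteIntegral_iff_ofReal (ae_of_all _ fun x => by positivity)]
  have h : stdGaussian (EuclideanSpace ℝ (Fin l)) Set.univ = 1 := measure_univ
  rw [stdGaussian_eq_withDensity, withDensity_apply _ MeasurableSet.univ,
    Measure.restrict_univ] at h
  rw [h]
  exact ENNReal.one_lt_top

/-- The density of `k` independent centred isotropic Gaussian vectors of variance `r`. -/
theorem map_smul_pi_stdGaussian (k l : ℕ) {r : ℝ} (hr : 0 < r) :
    (Measure.pi fun _ : Fin k => stdGaussian (EuclideanSpace ℝ (Fin l))).map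
      (fun u => √r • u) = volume.withDensity fun u => ENNReal.ofReal
        ((2 * Real.pi * r) ^ (-((k * l : ℝ) / 2)) *
          Real.exp (-(∑ j, ‖u j‖ ^ 2) / (2 * r))) := by
  have hpi := Real.pi_pos
  have h1 : (Measure.pi fun _ : Fin k => stdGaussian (EuclideanSpace ℝ (Fin l))) =
      volume.withDensity fun u : Fin k → EuclideanSpace ℝ (Fin l) => ENNReal.ofReal
        (∏ j, ((2 * Real.pi) ^ (-((l : ℝ) / 2)) * Real.exp (-‖u j‖ ^ 2 / 2))) := by
    rw [stdGaussian_eq_withDensity]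
    exact pi_withDensity_ofReal (fun _ : Fin k => (volume : Measure (EuclideanSpace ℝ (Fin l)))) _
      (fun _ => integrable_stdGaussian_density l) fun _ x => by positivity
  have hr' : √r ≠ 0 := (Real.sqrt_pos.2 hr).ne'
  rw [h1, map_smul_withDensity _ (by fun_prop) hr']
  congr 1
  ext u
  rw [← ENNReal.ofReal_mul (abs_nonneg _)]
  congr 1
  rw [Finset.prod_mul_distrib, ← Real.exp_sum, Finset.prod_const, Finset.card_univ,
    Fintype.card_fin, ← mul_assoc]
  congr 1
  · rw [Module.finrank_pi_fintype]
    simp only [finrank_euclideanSpace_fin, Finset.sum_const, Finset.card_univ, Fintype.card_fin,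
      smul_eq_mul]
    rw [abs_of_pos (by positivity), Real.mul_rpow (by positivity) hr.le, mul_comm]
    congr 1
    · rw [← Real.rpow_mul_natCast (by positivity)]
      congr 1
      ring
    · rw [Real.sqrt_eq_rpow, ← Real.rpow_natCast, ← Real.rpow_mul hr.le, ← Real.rpow_neg hr.le]
      congr 1
      push_cast
      ring
  · congr 1
    rw [← Finset.sum_div, Finset.sum_neg_distrib]
    simp only [Pi.smul_apply, norm_smul, norm_inv, Real.norm_eq_abs, mul_pow, inv_pow, sq_abs,
      Real.sq_sqrt hr.le]
    rw [← Finset.mul_sum]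
    field_simp

/-- The analogue for one vector of `map_smul_pi_stdGaussian`: this one feeds the Student density,
the other one the likelihood of the observations. -/
theorem map_smul_stdGaussian (l : ℕ) {r : ℝ} (hr : 0 < r) :
    (stdGaussian (EuclideanSpace ℝ (Fin l))).map (fun u => √r • u) =
      volume.withDensity fun u => ENNReal.ofReal
        ((2 * Real.pi * r) ^ (-((l : ℝ) / 2)) * Real.exp (-‖u‖ ^ 2 / (2 * r))) := by
  have hpi := Real.pi_pos
  have hr' : √r ≠ 0 := (Real.sqrt_pos.2 hr).ne'
  rw [stdGaussian_eq_withDensity, map_smul_withDensity _ (by fun_prop) hr']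
  congr 1
  ext u
  rw [← ENNReal.ofReal_mul (abs_nonneg _)]
  congr 1
  rw [← mul_assoc]
  congr 1
  · rw [finrank_euclideanSpace_fin, abs_of_pos (by positivity),
      Real.mul_rpow (by positivity) hr.le, mul_comm]
    congr 1
    rw [Real.sqrt_eq_rpow, ← Real.rpow_natCast, ← Real.rpow_mul hr.le, ← Real.rpow_neg hr.le]
    congr 1
    ring
  · congr 1
    simp only [norm_smul, norm_inv, Real.norm_eq_abs, mul_pow, inv_pow, sq_abs, Real.sq_sqrt hr.le]
    field_simp

instance isOpenPosMeasure_stdGaussian (l : ℕ) :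
    (stdGaussian (EuclideanSpace ℝ (Fin l))).IsOpenPosMeasure := by
  have hpi := Real.pi_pos
  rw [stdGaussian_eq_withDensity]
  refine isOpenPosMeasure_withDensity _ (by fun_prop) fun x => ?_
  rw [ne_eq, ENNReal.ofReal_eq_zero, not_le]
  positivity

end GaussianDensity

/-! ### Matrices as Euclidean maps; orthonormalization. -/

section LinearAlgebra

variable {n m l : ℕ}

theorem toEuclideanLin_mul_apply {p : ℕ} (M : Matrix (Fin n) (Fin m) ℝ)
    (N : Matrix (Fin m) (Fin p) ℝ) (v : EuclideanSpace ℝ (Fin p)) :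
    Matrix.toEuclideanLin (M * N) v = Matrix.toEuclideanLin M (Matrix.toEuclideanLin N v) := by
  simp [Matrix.toLpLin_apply, Matrix.mulVec_mulVec]

theorem toEuclideanLin_one_apply (v : EuclideanSpace ℝ (Fin n)) :
    Matrix.toEuclideanLin (1 : Matrix (Fin n) (Fin n) ℝ) v = v := by
  simp

theorem inner_toEuclideanLin_left (M : Matrix (Fin n) (Fin m) ℝ) (v : EuclideanSpace ℝ (Fin m))
    (w : EuclideanSpace ℝ (Fin n)) :
    inner ℝ (Matrix.toEuclideanLin M v) w = inner ℝ v (Matrix.toEuclideanLin Mᵀ w) := by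
  simp [Matrix.toLpLin_apply, EuclideanSpace.inner_eq_star_dotProduct, Matrix.dotProduct_mulVec,
    dotProduct_comm, Matrix.mulVec_transpose]

theorem continuous_toEuclideanLin (M : Matrix (Fin n) (Fin m) ℝ) :
    Continuous (Matrix.toEuclideanLin M) :=
  LinearMap.continuous_of_finiteDimensional _

theorem norm_toEuclideanLin_of_transpose_mul_self {Q : Matrix (Fin n) (Fin l) ℝ}
    (hQ : Qᵀ * Q = 1) (v : EuclideanSpace ℝ (Fin l)) : ‖Matrix.toEuclideanLin Q v‖ = ‖v‖ := by
  rw [← sq_eq_sq₀ (norm_nonneg _) (norm_nonneg _), ← real_inner_self_eq_norm_sq,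
    inner_toEuclideanLin_left, ← toEuclideanLin_mul_apply, hQ, toEuclideanLin_one_apply,
    real_inner_self_eq_norm_sq]

theorem le_of_transpose_mul_self {Q : Matrix (Fin n) (Fin l) ℝ} (hQ : Qᵀ * Q = 1) : l ≤ n := by
  have h : Q.rank = l := by
    rw [← Matrix.rank_transpose_mul_self, hQ, Matrix.rank_one, Fintype.card_fin]
  simpa [h] using Matrix.rank_le_height Q

open scoped MatrixOrder in
/-- The columns of `Y` can be orthonormalized without changing the projection onto their span. -/
theorem exists_orthonormal_columns {Y : Matrix (Fin n) (Fin l) ℝ}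
    (hY : LinearIndependent ℝ Y.col) :
    ∃ B : Matrix (Fin l) (Fin l) ℝ, (Y * B)ᵀ * (Y * B) = 1 ∧ (Y * B) * (Y * B)ᵀ = projP₂ Y := by
  have hG : (Yᵀ * Y).PosDef := by
    rw [← Matrix.conjTranspose_eq_transpose_of_trivial]
    exact Matrix.PosDef.conjTranspose_mul_self Y (Matrix.mulVec_injective_iff.2 hY)
  -- `B` is the symmetric square root of the inverse Gram matrix.
  obtain ⟨B, hB⟩ : ∃ B, (Yᵀ * Y)⁻¹ = Bᵀ * B := by
    refine ⟨CFC.sqrt (Yᵀ * Y)⁻¹, ?_⟩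
    have h := (CFC.sqrt_nonneg (Yᵀ * Y)⁻¹).isSelfAdjoint.star_eq
    rw [Matrix.star_eq_conjTranspose, Matrix.conjTranspose_eq_transpose_of_trivial] at h
    rw [h, CFC.sqrt_mul_sqrt_self _ hG.inv.posSemidef.nonneg]
  have hdet : IsUnit (Yᵀ * Y).det := hG.det_pos.ne'.isUnit
  refine ⟨Bᵀ, ?_, ?_⟩
  · have h1 : Bᵀ * (B * (Yᵀ * Y)) = 1 := by
      rw [← Matrix.mul_assoc, ← hB, Matrix.nonsing_inv_mul _ hdet]
    -- One-sided inverses of square matrices are two-sided, which moves `Bᵀ` to the right-hand end.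
    rw [mul_eq_one_comm] at h1
    simpa [Matrix.mul_assoc] using h1
  · rw [projP₂, hB]
    simp [Matrix.mul_assoc]

end LinearAlgebra

/-! ### Spectral data of `c Q Qᵀ` and the Student law it defines. -/

section ScaledProjection

variable {n l : ℕ} {Q : Matrix (Fin n) (Fin l) ℝ}

theorem range_smul_mul_transpose (hQ : Qᵀ * Q = 1) {c : ℝ} (hc : c ≠ 0) :
    LinearMap.range (Matrix.toEuclideanLin (c • (Q * Qᵀ))) =
      LinearMap.range (Matrix.toEuclideanLin Q) := by
  ext v
  simp only [LinearMap.mem_range]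
  constructor
  · rintro ⟨w, rfl⟩
    exact ⟨c • Matrix.toEuclideanLin Qᵀ w, by simp⟩
  · rintro ⟨w, rfl⟩
    refine ⟨c⁻¹ • Matrix.toEuclideanLin Q w, ?_⟩
    rw [map_smul, map_smul, LinearMap.smul_apply, toEuclideanLin_mul_apply,
      ← toEuclideanLin_mul_apply Qᵀ Q, hQ, toEuclideanLin_one_apply, inv_smul_smul₀ hc]

theorem rank_smul_mul_transpose (hQ : Qᵀ * Q = 1) {c : ℝ} (hc : c ≠ 0) :
    (c • (Q * Qᵀ)).rank = l := by
  have h : Q.rank = l := by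
    rw [← Matrix.rank_transpose_mul_self, hQ, Matrix.rank_one, Fintype.card_fin]
  rw [Matrix.rank_smul_of_mem_nonZeroDivisors _ (mem_nonZeroDivisors_of_ne_zero hc),
    Matrix.rank_self_mul_transpose, h]

/-- Exchanging the factors of `Q (c Qᵀ)` gives `c • 1` of size `l` and changes the characteristic
polynomial only by the factor `X ^ (n - l)`. -/
theorem pseudoDet_smul_mul_transpose (hQ : Qᵀ * Q = 1) {c : ℝ} (hc : c ≠ 0) :
    pseudoDet (c • (Q * Qᵀ)) = c ^ l := by
  have hle : Fintype.card (Fin l) ≤ Fintype.card (Fin n) := by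
    simpa using le_of_transpose_mul_self hQ
  have hchar : (c • (Q * Qᵀ)).charpoly =
      Polynomial.X ^ (n - l) * (Polynomial.X - Polynomial.C c) ^ l := by
    rw [← Matrix.mul_smul, Matrix.charpoly_mul_comm_of_le _ _ hle, Matrix.smul_mul, hQ,
      Matrix.smul_one_eq_diagonal, Matrix.charpoly_diagonal]
    simp
  have hne : (Polynomial.X ^ (n - l) * (Polynomial.X - Polynomial.C c) ^ l : Polynomial ℝ) ≠ 0 :=
    mul_ne_zero (pow_ne_zero _ Polynomial.X_ne_zero) (pow_ne_zero _ (Polynomial.X_sub_C_ne_zero c))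
  rw [pseudoDet, hchar, Polynomial.roots_mul hne, Polynomial.roots_pow, Polynomial.roots_pow,
    Polynomial.roots_X, Polynomial.roots_X_sub_C, Multiset.filter_add, Multiset.filter_nsmul,
    Multiset.filter_nsmul]
  simp [Multiset.filter_singleton, hc, Multiset.prod_nsmul]

/-- The spectrum lies in `{0, c}`, where inversion agrees with the linear function `t ↦ c⁻² t`. -/
theorem symmPinv_smul_mul_transpose (hQ : Qᵀ * Q = 1) {c : ℝ} (hc : c ≠ 0) :
    symmPinv (c • (Q * Qᵀ)) = c⁻¹ • (Q * Qᵀ) := by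
  have hidem : IsIdempotentElem (Q * Qᵀ) := by
    rw [IsIdempotentElem, Matrix.mul_assoc, ← Matrix.mul_assoc Qᵀ, hQ, Matrix.one_mul]
  have hsa : IsSelfAdjoint (c • (Q * Qᵀ)) := by
    rw [isSelfAdjoint_iff, Matrix.star_eq_conjTranspose,
      Matrix.conjTranspose_eq_transpose_of_trivial]
    simp
  have hspec : ∀ t ∈ spectrum ℝ (c • (Q * Qᵀ)), t⁻¹ = (c⁻¹ * c⁻¹) * t := by
    intro t ht
    have h1 := spectrum.unit_smul_eq_smul (Q * Qᵀ) (Units.mk0 c hc)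
    rw [Units.smul_def, Units.val_mk0] at h1
    rw [h1] at ht
    obtain ⟨u, hu, rfl⟩ := Set.mem_smul_set.1 ht
    rcases hidem.spectrum_subset ℝ hu with rfl | hu1
    · simp
    · rw [Set.mem_singleton_iff.1 hu1]
      simp [Units.smul_def, hc]
  rw [symmPinv, cfc_congr hspec, cfc_const_mul_id (c⁻¹ * c⁻¹) (c • (Q * Qᵀ)) hsa, smul_smul]
  congr 1
  field_simp

/-- The coordinates given by orthonormal columns on the range of a multiple of the projection. -/
noncomputable def rangeIsometryEquiv (hQ : Qᵀ * Q = 1) {c : ℝ} (hc : c ≠ 0) :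
    EuclideanSpace ℝ (Fin l) ≃ₗᵢ[ℝ] LinearMap.range (Matrix.toEuclideanLin (c • (Q * Qᵀ))) :=
  LinearIsometryEquiv.ofSurjective
    { toLinearMap := (Matrix.toEuclideanLin Q).codRestrict _ fun v => by
        rw [range_smul_mul_transpose hQ hc]; exact LinearMap.mem_range_self _ v
      norm_map' := fun v => norm_toEuclideanLin_of_transpose_mul_self hQ v }
    (by
      rintro ⟨v, hv⟩
      have hv' := hv
      rw [range_smul_mul_transpose hQ hc] at hv'
      obtain ⟨w, rfl⟩ := hv'
      exact ⟨w, rfl⟩)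

theorem coe_rangeIsometryEquiv (hQ : Qᵀ * Q = 1) {c : ℝ} (hc : c ≠ 0)
    (v : EuclideanSpace ℝ (Fin l)) :
    (rangeIsometryEquiv hQ hc v : EuclideanSpace ℝ (Fin n)) = Matrix.toEuclideanLin Q v := rfl

/-- With `ν = 2 a` and scale `b / a`, the base of the Student power is `(b + ‖v‖² / 2) / b`, and
`√((π ν)ˡ det D)` is `(2 π b) ^ (l / 2)`; the remaining powers of `b` combine to `b ^ a`. -/
theorem studentPDFReal_smul_mul_transpose (hQ : Qᵀ * Q = 1) {a b : ℝ} (ha : 0 < a) (hb : 0 < b)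
    (μ : EuclideanSpace ℝ (Fin n)) (v : EuclideanSpace ℝ (Fin l)) :
    studentPDFReal (2 * a) μ ((b / a) • (Q * Qᵀ)) (μ + Matrix.toEuclideanLin Q v) =
      evidence a b l (‖v‖ ^ 2) := by
  have hc : b / a ≠ 0 := (div_pos hb ha).ne'
  have hpi := Real.pi_pos
  have hΓ := Real.Gamma_pos_of_pos ha
  rw [studentPDFReal, rank_smul_mul_transpose hQ hc, pseudoDet_smul_mul_transpose hQ hc,
    symmPinv_smul_mul_transpose hQ hc, add_sub_cancel_left]
  have hin : inner ℝ (Matrix.toEuclideanLin Q v)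
      (Matrix.toEuclideanLin ((b / a)⁻¹ • (Q * Qᵀ)) (Matrix.toEuclideanLin Q v)) =
      a / b * ‖v‖ ^ 2 := by
    rw [map_smul, LinearMap.smul_apply, toEuclideanLin_mul_apply, ← toEuclideanLin_mul_apply Qᵀ Q,
      hQ, toEuclideanLin_one_apply, inner_smul_right, real_inner_self_eq_norm_sq,
      norm_toEuclideanLin_of_transpose_mul_self hQ, inv_div]
  have hexp : (2 * a + (l : ℝ)) / 2 = a + l / 2 := by ring
  have hbase : 1 + 1 / (2 * a) * (a / b * ‖v‖ ^ 2) = (b + ‖v‖ ^ 2 / 2) / b := by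
    field_simp
  have hsqrt : √((Real.pi * (2 * a)) ^ l * (b / a) ^ l) =
      (2 * Real.pi) ^ ((l : ℝ) / 2) * b ^ ((l : ℝ) / 2) := by
    rw [← mul_pow, show Real.pi * (2 * a) * (b / a) = 2 * Real.pi * b by field_simp,
      Real.sqrt_eq_rpow, ← Real.rpow_natCast, ← Real.rpow_mul (by positivity),
      ← Real.mul_rpow (by positivity) hb.le]
    congr 1
    ring
  rw [hin, hexp, hbase, hsqrt, Real.div_rpow (by positivity) hb.le, evidence,
    Real.rpow_neg (by positivity), Real.rpow_add hb, show 2 * a / 2 = a by ring]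
  have h1 : 0 < b ^ ((l : ℝ) / 2) := Real.rpow_pos_of_pos hb _
  have h2 : 0 < b ^ a := Real.rpow_pos_of_pos hb _
  have h3 : 0 < (2 * Real.pi) ^ ((l : ℝ) / 2) := Real.rpow_pos_of_pos (by positivity) _
  have h4 : 0 < (b + ‖v‖ ^ 2 / 2) ^ (a + (l : ℝ) / 2) := Real.rpow_pos_of_pos (by positivity) _
  field_simp

/-- The multivariate Student distribution is an inverse-gamma scale mixture of Gaussians. -/
theorem multivariateStudent_eq_map (hQ : Qᵀ * Q = 1) {a b : ℝ} (ha : 0 < a) (hb : 0 < b)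
    (μ : EuclideanSpace ℝ (Fin n)) :
    multivariateStudent (2 * a) μ ((b / a) • (Q * Qᵀ)) =
      ((invGamma a b).prod (stdGaussian (EuclideanSpace ℝ (Fin l)))).map
        fun p => μ + √p.1 • Matrix.toEuclideanLin Q p.2 := by
  have hc : b / a ≠ 0 := (div_pos hb ha).ne'
  have hQm : Measurable (Matrix.toEuclideanLin Q) := (continuous_toEuclideanLin Q).measurable
  have hprob := isProbabilityMeasure_invGamma ha hb
  refine Measure.ext_of_lintegral _ fun f hf => ?_
  have hR : ∫⁻ x, f x ∂(((invGamma a b).prod (stdGaussian (EuclideanSpace ℝ (Fin l)))).map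
        fun p => μ + √p.1 • Matrix.toEuclideanLin Q p.2) =
      ∫⁻ v : EuclideanSpace ℝ (Fin l), ENNReal.ofReal (evidence a b l (‖v‖ ^ 2)) *
        f (μ + Matrix.toEuclideanLin Q v) := by
    rw [lintegral_map hf (by fun_prop), lintegral_prod _ (by fun_prop)]
    have hstep : ∀ r : ℝ, ∫⁻ w, f (μ + √r • Matrix.toEuclideanLin Q w)
        ∂(stdGaussian (EuclideanSpace ℝ (Fin l))) =
        ∫⁻ v, f (μ + Matrix.toEuclideanLin Q v)
          ∂((stdGaussian (EuclideanSpace ℝ (Fin l))).map fun u => √r • u) := by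
      intro r
      rw [lintegral_map (by fun_prop) (by fun_prop)]
      simp
    simp_rw [hstep]
    rw [lintegral_invGamma_gaussian (volume : Measure (EuclideanSpace ℝ (Fin l)))
      (N := fun v => ‖v‖ ^ 2) (by fun_prop) (fun v => by positivity) ha hb (Nat.cast_nonneg l)
      (fun r => (stdGaussian (EuclideanSpace ℝ (Fin l))).map fun u => √r • u)
      (fun r hr => map_smul_stdGaussian l hr)
      (f := fun _ v => f (μ + Matrix.toEuclideanLin Q v)) (by fun_prop)]
    -- The integrand does not involve the scale, so the updated inverse-gamma law contributes only
    -- its mass `1`.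
    refine lintegral_congr fun v => ?_
    have := isProbabilityMeasure_invGamma (α := a + (l : ℝ) / 2) (β := b + ‖v‖ ^ 2 / 2)
      (by positivity) (by positivity)
    simp
  have hpdf : Measurable fun x => ENNReal.ofReal
      (studentPDFReal (2 * a) μ ((b / a) • (Q * Qᵀ)) x) := by
    have := (continuous_toEuclideanLin (symmPinv ((b / a) • (Q * Qᵀ)))).measurable
    unfold studentPDFReal
    fun_prop
  have hT : Measurable fun t : LinearMap.range (Matrix.toEuclideanLin ((b / a) • (Q * Qᵀ))) =>
      μ + (t : EuclideanSpace ℝ (Fin n)) := by fun_prop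
  have hpdfT : Measurable fun t : LinearMap.range (Matrix.toEuclideanLin ((b / a) • (Q * Qᵀ))) =>
      ENNReal.ofReal (studentPDFReal (2 * a) μ ((b / a) • (Q * Qᵀ))
        (μ + (t : EuclideanSpace ℝ (Fin n)))) := hpdf.comp hT
  have hfT : Measurable fun t : LinearMap.range (Matrix.toEuclideanLin ((b / a) • (Q * Qᵀ))) =>
      f (μ + (t : EuclideanSpace ℝ (Fin n))) := hf.comp hT
  -- The isometry given by `Q` preserves Lebesgue measure, which moves the integral from the
  -- subspace to the coordinates `v`.
  rw [hR, multivariateStudent, lintegral_map hf (by fun_prop),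
    lintegral_withDensity_eq_lintegral_mul₀ hpdfT.aemeasurable (by fun_prop),
    ← (rangeIsometryEquiv hQ hc).measurePreserving.lintegral_comp
      (hpdfT.mul hfT)]
  refine lintegral_congr fun v => ?_
  simp only [Pi.mul_apply, coe_rangeIsometryEquiv, studentPDFReal_smul_mul_transpose hQ ha hb]

end ScaledProjection

/-! ### Fibre laws as continuous images of one fixed measure. -/

section Disintegration

/-- A disintegration with fibre laws `μ.map (g (t, ·))`, where `g` is continuous in `t`, gives both
the regular conditional distributions and the conditional laws at single points. -/
theorem condDistrib_and_hasCondLawAt_of_lintegral {Ω F T Θ₀ Θ : Type*} [MeasurableSpace Ω]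
    [TopologicalSpace F] [MeasurableSpace F] [BorelSpace F] [StandardBorelSpace F] [Nonempty F]
    [PseudoMetricSpace T] [MeasurableSpace T] [BorelSpace T]
    [TopologicalSpace Θ₀] [MeasurableSpace Θ₀] [OpensMeasurableSpace Θ₀] [MeasurableSpace Θ]
    {P : Measure Ω} [IsProbabilityMeasure P] {Z : Ω → F} {D : Ω → T} (hZ : Measurable Z)
    (hD : Measurable D) (ρ : Measure Θ₀) [SFinite ρ] [ρ.IsOpenPosMeasure] (μ : Measure Θ)
    [IsProbabilityMeasure μ] {a : Θ₀ → T} (hac : Continuous a) {g : T × Θ → F}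
    (hgm : Measurable g) (hgc : ∀ θ, Continuous fun t => g (t, θ))
    (h : ∀ f : T × F → ℝ≥0∞, Measurable f →
      ∫⁻ ω, f (D ω, Z ω) ∂P = ∫⁻ q, ∫⁻ θ, f (a q, g (a q, θ)) ∂μ ∂ρ) :
    (∀ᵐ d ∂(P.map D), condDistrib Z D P d = μ.map fun θ => g (d, θ)) ∧
      ∀ q, HasCondLawAt P Z D (a q) (μ.map fun θ => g (a q, θ)) := by
  have ham : Measurable a := hac.measurable
  have hgt : ∀ t, Measurable fun θ => g (t, θ) := fun t => hgm.comp measurable_prodMk_left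
  let κ : Kernel T F := (Kernel.id ×ₖ Kernel.const T μ).map g
  have hκM : IsMarkovKernel κ := Kernel.IsMarkovKernel.map _ hgm
  have hκ : ∀ t, κ t = μ.map fun θ => g (t, θ) := by
    intro t
    simp only [κ]
    rw [Kernel.map_apply _ hgm, Kernel.prod_apply, Kernel.id_apply, Kernel.const_apply,
      Measure.dirac_prod, Measure.map_map hgm measurable_prodMk_left]
    rfl
  have hcomp : P.map (fun ω => (D ω, Z ω)) = ρ.map a ⊗ₘ κ := by
    refine Measure.ext_of_lintegral _ fun f hf => ?_
    rw [lintegral_map hf (hD.prodMk hZ), h f hf, Measure.lintegral_compProd hf,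
      lintegral_map hf.lintegral_kernel_prod_right' ham]
    refine lintegral_congr fun q => ?_
    rw [hκ, lintegral_map (f := fun z => f (a q, z)) (hf.comp measurable_prodMk_left) (hgt _)]
  obtain ⟨hmap, hdis⟩ := map_prodMk_eq_compProd hZ κ (ρ.map a) hcomp
  refine ⟨?_, fun q => ?_⟩
  · filter_upwards [condDistrib_ae_eq_of_measure_eq_compProd D hZ.aemeasurable hdis] with d hd
    rw [hd, hκ]
  · rw [← hκ]
    refine hasCondLawAt_of_map_eq_compProd hZ hD κ hdis (fun f => ?_) fun ε hε => ?_
    · simp_rw [hκ]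
      have hint : ∀ t, ∫ z, f z ∂(μ.map fun θ => g (t, θ)) = ∫ θ, f (g (t, θ)) ∂μ := fun t =>
        integral_map (hgt t).aemeasurable f.continuous.measurable.aestronglyMeasurable
      simp_rw [hint]
      -- The measure `μ` does not depend on `t`, so weak continuity is dominated convergence.
      refine (continuous_of_dominated (bound := fun _ => ‖f‖) (fun t => ?_) (fun t => ?_)
        (integrable_const _) ?_).continuousAt
      · exact (f.continuous.measurable.comp (hgt t)).aestronglyMeasurable
      · exact ae_of_all _ fun θ => f.norm_coe_le_norm _
      · exact ae_of_all _ fun θ => f.continuous.comp (hgc θ)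
    · have hB : MeasurableSet (Metric.ball (a q) ε) := Metric.isOpen_ball.measurableSet
      rw [← Measure.map_apply hD hB, hmap, Measure.map_apply ham hB]
      -- The preimage of the ball under `a` is open and contains `q`.
      exact (Metric.isOpen_ball.preimage hac).measure_ne_zero ρ
        ⟨q, Metric.mem_ball_self hε⟩

end Disintegration

/-! ### The conditional Gaussian law as an image of standard Gaussians. -/

section GaussianModel

variable {n m l : ℕ}

theorem charFun_map_toEuclideanLin_stdGaussian (M : Matrix (Fin n) (Fin m) ℝ)
    (t : EuclideanSpace ℝ (Fin n)) :
    charFun ((stdGaussian (EuclideanSpace ℝ (Fin m))).map (Matrix.toEuclideanLin M)) t =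
      Complex.exp (-‖Matrix.toEuclideanLin Mᵀ t‖ ^ 2 / 2) := by
  have hM := (continuous_toEuclideanLin M).measurable
  rw [← charFun_stdGaussian, charFun_apply, charFun_apply,
    integral_map hM.aemeasurable (Measurable.aestronglyMeasurable (by fun_prop))]
  simp_rw [inner_toEuclideanLin_left]

/-- Both characteristic functions at `t` equal `exp (i⟪t, x₀⟫ - (‖Vᵀ t‖² + r ‖Qᵀ t‖²) / 2)`. -/
theorem multivariateGaussian_eq_map (x₀ : EuclideanSpace ℝ (Fin n)) (V : Matrix (Fin n) (Fin m) ℝ)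
    (Q : Matrix (Fin n) (Fin l) ℝ) {r : ℝ} (hr : 0 ≤ r) :
    multivariateGaussian x₀ (V * Vᵀ + r • (Q * Qᵀ)) =
      ((stdGaussian (EuclideanSpace ℝ (Fin m))).prod (stdGaussian (EuclideanSpace ℝ (Fin l)))).map
        fun p => x₀ + (Matrix.toEuclideanLin V p.1 + √r • Matrix.toEuclideanLin Q p.2) := by
  have hV := (continuous_toEuclideanLin V).measurable
  have hQ := (continuous_toEuclideanLin Q).measurable
  have hQr := (continuous_toEuclideanLin (√r • Q)).measurable
  have hps : ∀ {j : ℕ} (M : Matrix (Fin n) (Fin j) ℝ), (M * Mᵀ).PosSemidef := fun M => by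
    rw [← Matrix.conjTranspose_eq_transpose_of_trivial]
    exact Matrix.posSemidef_self_mul_conjTranspose M
  have hS : (V * Vᵀ + r • (Q * Qᵀ)).PosSemidef := (hps V).add ((hps Q).smul hr)
  have hmap : ((stdGaussian (EuclideanSpace ℝ (Fin m))).prod
      (stdGaussian (EuclideanSpace ℝ (Fin l)))).map
        (fun p => x₀ + (Matrix.toEuclideanLin V p.1 + √r • Matrix.toEuclideanLin Q p.2)) =
      ((((stdGaussian (EuclideanSpace ℝ (Fin m))).map (Matrix.toEuclideanLin V)).prod
        ((stdGaussian (EuclideanSpace ℝ (Fin l))).map (Matrix.toEuclideanLin (√r • Q)))).map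
          fun p => p.1 + p.2).map fun v => x₀ + v := by
    rw [Measure.map_prod_map _ _ hV hQr, Measure.map_map (by fun_prop) (by fun_prop),
      Measure.map_map (by fun_prop) (by fun_prop)]
    congr 1
    ext1 p
    simp
  have hp1 : IsProbabilityMeasure ((stdGaussian (EuclideanSpace ℝ (Fin m))).map
    (Matrix.toEuclideanLin V)) := Measure.isProbabilityMeasure_map hV.aemeasurable
  have hp2 : IsProbabilityMeasure ((stdGaussian (EuclideanSpace ℝ (Fin l))).map
    (Matrix.toEuclideanLin (√r • Q))) := Measure.isProbabilityMeasure_map hQr.aemeasurable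
  rw [hmap]
  have hp3 := Measure.isProbabilityMeasure_map (μ := ((stdGaussian (EuclideanSpace ℝ (Fin m))).map
    (Matrix.toEuclideanLin V)).prod ((stdGaussian (EuclideanSpace ℝ (Fin l))).map
      (Matrix.toEuclideanLin (√r • Q)))) (f := fun p => p.1 + p.2) (by fun_prop)
  have hp4 := Measure.isProbabilityMeasure_map (μ := (((stdGaussian (EuclideanSpace ℝ (Fin m))).map
    (Matrix.toEuclideanLin V)).prod ((stdGaussian (EuclideanSpace ℝ (Fin l))).map
      (Matrix.toEuclideanLin (√r • Q)))).map fun p => p.1 + p.2) (f := fun v => x₀ + v)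
        (by fun_prop)
  refine Measure.ext_of_charFun (funext fun t => ?_)
  have hnorm : ∀ {j : ℕ} (M : Matrix (Fin n) (Fin j) ℝ),
      t ⬝ᵥ (M * Mᵀ) *ᵥ t = ‖Matrix.toEuclideanLin Mᵀ t‖ ^ 2 := fun M => by
    rw [EuclideanSpace.real_norm_sq_eq, ← Matrix.mulVec_mulVec, Matrix.dotProduct_mulVec,
      ← Matrix.mulVec_transpose]
    simp [Matrix.toLpLin_apply, dotProduct, sq]
  rw [charFun_multivariateGaussian hS, charFun_map_const_add, charFun_map_add_prod_eq_mul,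
    Pi.mul_apply, charFun_map_toEuclideanLin_stdGaussian, charFun_map_toEuclideanLin_stdGaussian,
    ← Complex.exp_add, ← Complex.exp_add, Matrix.add_mulVec, dotProduct_add, Matrix.smul_mulVec,
    dotProduct_smul, hnorm, hnorm, Matrix.transpose_smul, map_smul, LinearMap.smul_apply, norm_smul,
    Real.norm_eq_abs, abs_of_nonneg (Real.sqrt_nonneg r), real_inner_comm]
  congr 1
  have : ((√r : ℝ) : ℂ) ^ 2 = r := by rw [← Complex.ofReal_pow, Real.sq_sqrt hr]
  push_cast [smul_eq_mul]
  rw [mul_pow, this]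
  ring

theorem map_projection_multivariateGaussian (x₀ : EuclideanSpace ℝ (Fin n))
    {V : Matrix (Fin n) (Fin m) ℝ} {Q : Matrix (Fin n) (Fin l) ℝ} {R : Matrix (Fin n) (Fin n) ℝ}
    (hRV : R * V = 0) (hRQ : R * Q = Q) {r : ℝ} (hr : 0 ≤ r) :
    (multivariateGaussian x₀ (V * Vᵀ + r • (Q * Qᵀ))).map
        (fun v => Matrix.toEuclideanLin R (v - x₀)) =
      (stdGaussian (EuclideanSpace ℝ (Fin l))).map fun w => √r • Matrix.toEuclideanLin Q w := by
  have hV := (continuous_toEuclideanLin V).measurable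
  have hQ := (continuous_toEuclideanLin Q).measurable
  have hR := (continuous_toEuclideanLin R).measurable
  have hsnd : ((stdGaussian (EuclideanSpace ℝ (Fin m))).prod
      (stdGaussian (EuclideanSpace ℝ (Fin l)))).map Prod.snd =
      stdGaussian (EuclideanSpace ℝ (Fin l)) := measurePreserving_snd.map_eq
  rw [multivariateGaussian_eq_map x₀ V Q hr, Measure.map_map (by fun_prop) (by fun_prop), ← hsnd,
    Measure.map_map (by fun_prop) measurable_snd, hsnd]
  congr 1
  ext1 p
  simp only [Function.comp_apply, add_sub_cancel_left, map_add, map_smul]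
  rw [← toEuclideanLin_mul_apply, ← toEuclideanLin_mul_apply, hRV, hRQ]
  simp

end GaussianModel

/-! ### The oblique projection `P₁` and the scale update. -/

section ProjectionMethod

variable {n m : ℕ} {A : Matrix (Fin n) (Fin n) ℝ} {V W : Matrix (Fin n) (Fin m) ℝ}

theorem projP₁_mul_basis (hWAV : (Wᵀ * A * V).det ≠ 0) : projP₁ A V W * V = 0 := by
  have h := Matrix.nonsing_inv_mul (Wᵀ * A * V) hWAV.isUnit
  have h2 : V * (Wᵀ * A * V)⁻¹ * Wᵀ * A * V = V * ((Wᵀ * A * V)⁻¹ * (Wᵀ * A * V)) := by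
    simp only [Matrix.mul_assoc]
  rw [projP₁, Matrix.sub_mul, Matrix.one_mul, h2, h, Matrix.mul_one, sub_self]

theorem projP₁_mul_of_mul_eq_zero {l : ℕ} {Q : Matrix (Fin n) (Fin l) ℝ} (hQ : Wᵀ * A * Q = 0) :
    projP₁ A V W * Q = Q := by
  have h2 : V * (Wᵀ * A * V)⁻¹ * Wᵀ * A * Q = V * (Wᵀ * A * V)⁻¹ * (Wᵀ * A * Q) := by
    simp only [Matrix.mul_assoc]
  rw [projP₁, Matrix.sub_mul, Matrix.one_mul, h2, hQ, Matrix.mul_zero, sub_zero]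

theorem mul_projP₁ (hWAV : (Wᵀ * A * V).det ≠ 0) : Wᵀ * A * projP₁ A V W = 0 := by
  have h := Matrix.mul_nonsing_inv (Wᵀ * A * V) hWAV.isUnit
  have h2 : Wᵀ * A * (V * (Wᵀ * A * V)⁻¹ * Wᵀ * A) =
      (Wᵀ * A * V) * (Wᵀ * A * V)⁻¹ * (Wᵀ * A) := by
    simp only [Matrix.mul_assoc]
  rw [projP₁, Matrix.mul_sub, Matrix.mul_one, h2, h, Matrix.one_mul, sub_self]

/-- Invertibility of `Wᵀ A V` makes `Wᵀ A` surjective, so its kernel has dimension `n - m`. It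
contains `Range Q`, which has the same dimension, and `Wᵀ A P₁ = 0` puts `Range P₁` in that kernel.
-/
theorem range_projP₁_le (hWAV : (Wᵀ * A * V).det ≠ 0) {Q : Matrix (Fin n) (Fin (n - m)) ℝ}
    (hQ : Qᵀ * Q = 1) (hWAQ : Wᵀ * A * Q = 0) :
    LinearMap.range (Matrix.toEuclideanLin (projP₁ A V W)) ≤
      LinearMap.range (Matrix.toEuclideanLin Q) := by
  have hsurj : LinearMap.range (Matrix.toEuclideanLin (Wᵀ * A)) = ⊤ := by
    refine LinearMap.range_eq_top.2 fun y =>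
      ⟨Matrix.toEuclideanLin (V * (Wᵀ * A * V)⁻¹) y, ?_⟩
    rw [← toEuclideanLin_mul_apply, ← Matrix.mul_assoc,
      Matrix.mul_nonsing_inv _ hWAV.isUnit, toEuclideanLin_one_apply]
  have hinj : Function.Injective (Matrix.toEuclideanLin Q) := by
    refine (injective_iff_map_eq_zero _).2 fun v hv => ?_
    rw [← norm_eq_zero, ← norm_toEuclideanLin_of_transpose_mul_self hQ, hv, norm_zero]
  have hle : LinearMap.range (Matrix.toEuclideanLin Q) ≤
      LinearMap.ker (Matrix.toEuclideanLin (Wᵀ * A)) := by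
    rintro _ ⟨v, rfl⟩
    rw [LinearMap.mem_ker, ← toEuclideanLin_mul_apply, hWAQ]
    simp
  have hker := LinearMap.finrank_range_add_finrank_ker (Matrix.toEuclideanLin (Wᵀ * A))
  have hrQ := LinearMap.finrank_range_of_inj hinj
  rw [hsurj, finrank_top] at hker
  simp only [finrank_euclideanSpace_fin] at hker hrQ
  rw [Submodule.eq_of_le_of_finrank_eq hle (by omega)]
  rintro _ ⟨v, rfl⟩
  rw [LinearMap.mem_ker, ← toEuclideanLin_mul_apply, mul_projP₁ hWAV]
  simp

theorem postScale_eq {n k : ℕ} (β : ℝ) (X : Fin k → EuclideanSpace ℝ (Fin n)) :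
    postScale β X = β + (∑ j, ‖X j‖ ^ 2) / 2 := by
  simp only [postScale, Matrix.trace, Matrix.diag, Matrix.mul_apply, Matrix.transpose_apply,
    colMatrix, Matrix.of_apply, EuclideanSpace.real_norm_sq_eq]
  simp only [sq]

theorem postScale_pos {n k : ℕ} {β : ℝ} (hβ : 0 < β) (X : Fin k → EuclideanSpace ℝ (Fin n)) :
    0 < postScale β X := by
  rw [postScale_eq]
  positivity

theorem continuous_postScale {n k : ℕ} (β : ℝ) :
    Continuous (postScale β : (Fin k → EuclideanSpace ℝ (Fin n)) → ℝ) := by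
  simp only [funext (postScale_eq (n := n) (k := k) β)]
  fun_prop

end ProjectionMethod

/-! ### Joint law of scale, unknown and observations. -/

section JointLaw

variable {n m l k : ℕ} {Ω : Type*} [MeasurableSpace Ω]

/-- The joint law of scale, unknown and observations, disintegrated along the observations.
Here `R` is a projection with kernel `Range V` and image `Range Q`. -/
theorem lintegral_model (x₀ : EuclideanSpace ℝ (Fin n)) {V : Matrix (Fin n) (Fin m) ℝ}
    {Q : Matrix (Fin n) (Fin l) ℝ} {R : Matrix (Fin n) (Fin n) ℝ} (hQ : Qᵀ * Q = 1)
    (hRV : R * V = 0) (hRQ : R * Q = Q) {α β : ℝ} (hα : 0 < α) (hβ : 0 < β)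
    {P : Measure Ω} [IsProbabilityMeasure P] {s : Ω → ℝ} {x : Ω → EuclideanSpace ℝ (Fin n)}
    {X : Ω → Fin k → EuclideanSpace ℝ (Fin n)}
    (hs : Measurable s) (hx : Measurable x) (hX : Measurable X)
    (hs_law : P.map s = invGamma α β)
    (h_model : ∀ᵐ r ∂(P.map s),
      condDistrib (fun ω => (x ω, X ω)) s P r =
        (multivariateGaussian x₀ (V * Vᵀ + r • (Q * Qᵀ))).prod
          (Measure.pi fun _ : Fin k =>
            (multivariateGaussian x₀ (V * Vᵀ + r • (Q * Qᵀ))).map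
              fun v => Matrix.toEuclideanLin R (v - x₀)))
    {f : ℝ → EuclideanSpace ℝ (Fin n) → (Fin k → EuclideanSpace ℝ (Fin n)) → ℝ≥0∞}
    (hf : Measurable fun q : ℝ × EuclideanSpace ℝ (Fin n) × (Fin k → EuclideanSpace ℝ (Fin n)) =>
      f q.1 q.2.1 q.2.2) :
    ∫⁻ ω, f (s ω) (x ω) (X ω) ∂P =
      ∫⁻ u : Fin k → EuclideanSpace ℝ (Fin l),
        ENNReal.ofReal (evidence α β (k * l) (∑ j, ‖u j‖ ^ 2)) *
          ∫⁻ t, ∫⁻ p, f (postScale β (fun j => Matrix.toEuclideanLin Q (u j)) * t)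
              (x₀ + (Matrix.toEuclideanLin V p.1 +
                √(postScale β (fun j => Matrix.toEuclideanLin Q (u j)) * t) •
                  Matrix.toEuclideanLin Q p.2))
              (fun j => Matrix.toEuclideanLin Q (u j))
            ∂((stdGaussian (EuclideanSpace ℝ (Fin m))).prod
              (stdGaussian (EuclideanSpace ℝ (Fin l)))) ∂(invGamma (α + k * l / 2) 1) := by
  have hVm := (continuous_toEuclideanLin V).measurable
  have hQm := (continuous_toEuclideanLin Q).measurable
  set γ := (stdGaussian (EuclideanSpace ℝ (Fin m))).prod (stdGaussian (EuclideanSpace ℝ (Fin l)))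
  -- `F r u` is the average over the unknown, for scale `r` and observation coordinates `u`; Bayes'
  -- formula then concerns `r` and `u` alone.
  let F : ℝ → (Fin k → EuclideanSpace ℝ (Fin l)) → ℝ≥0∞ := fun r u =>
    ∫⁻ p, f r (x₀ + (Matrix.toEuclideanLin V p.1 + √r • Matrix.toEuclideanLin Q p.2))
      (fun j => Matrix.toEuclideanLin Q (u j)) ∂γ
  have hFm : Measurable (Function.uncurry F) := by
    refine Measurable.lintegral_prod_right' (f := fun q : (ℝ × (Fin k → EuclideanSpace ℝ (Fin l))) ×
      (EuclideanSpace ℝ (Fin m) × EuclideanSpace ℝ (Fin l)) => f q.1.1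
        (x₀ + (Matrix.toEuclideanLin V q.2.1 + √q.1.1 • Matrix.toEuclideanLin Q q.2.2))
        (fun j => Matrix.toEuclideanLin Q (q.1.2 j))) ?_
    exact hf.comp (f := fun q : (ℝ × (Fin k → EuclideanSpace ℝ (Fin l))) ×
      (EuclideanSpace ℝ (Fin m) × EuclideanSpace ℝ (Fin l)) => (q.1.1,
        (x₀ + (Matrix.toEuclideanLin V q.2.1 + √q.1.1 • Matrix.toEuclideanLin Q q.2.2),
        (fun j => Matrix.toEuclideanLin Q (q.1.2 j))))) (by fun_prop)
  have hprior : ∫⁻ ω, f (s ω) (x ω) (X ω) ∂P =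
      ∫⁻ r, ∫⁻ u, F r u ∂((Measure.pi fun _ : Fin k =>
        stdGaussian (EuclideanSpace ℝ (Fin l))).map fun u => √r • u) ∂(invGamma α β) := by
    have h1 : ∫⁻ ω, f (s ω) (x ω) (X ω) ∂P =
        ∫⁻ q, f q.1 q.2.1 q.2.2 ∂(P.map fun ω => (s ω, (x ω, X ω))) := by
      rw [lintegral_map hf (by fun_prop)]
    rw [h1, ← compProd_map_condDistrib (hx.prodMk hX).aemeasurable, Measure.lintegral_compProd hf,
      ← hs_law]
    refine lintegral_congr_ae ?_
    have hpos : ∀ᵐ r ∂(P.map s), 0 < r := hs_law ▸ invGamma_ae_pos α β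
    filter_upwards [h_model, hpos] with r hr hr0
    have hfr : Measurable fun q : EuclideanSpace ℝ (Fin n) × (Fin k → EuclideanSpace ℝ (Fin n)) =>
      f r q.1 q.2 := hf.comp measurable_prodMk_left
    have hg : Measurable fun w : EuclideanSpace ℝ (Fin l) => √r • Matrix.toEuclideanLin Q w := by
      fun_prop
    have hpg : IsProbabilityMeasure ((stdGaussian (EuclideanSpace ℝ (Fin l))).map
      fun w => √r • Matrix.toEuclideanLin Q w) := Measure.isProbabilityMeasure_map hg.aemeasurable
    have hFr : Measurable (F r) := hFm.comp measurable_prodMk_left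
    rw [hr, map_projection_multivariateGaussian x₀ hRV hRQ hr0.le,
      ← Measure.pi_map_pi (fun _ => hg.aemeasurable), lintegral_prod_symm' _ hfr,
      lintegral_map hfr.lintegral_prod_left' (by fun_prop), lintegral_map hFr (by fun_prop)]
    refine lintegral_congr fun u => ?_
    have hfu : Measurable fun y => f r y fun j => √r • Matrix.toEuclideanLin Q (u j) :=
      hfr.comp measurable_prodMk_right
    rw [multivariateGaussian_eq_map x₀ V Q hr0.le, lintegral_map hfu (by fun_prop)]
    simp only [F, Pi.smul_apply, map_smul]
    rfl
  rw [hprior, lintegral_invGamma_gaussian (volume : Measure (Fin k → EuclideanSpace ℝ (Fin l)))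
    (N := fun u => ∑ j, ‖u j‖ ^ 2) (by fun_prop) (fun u => by positivity) hα hβ
    (d := (k * l : ℝ)) (by positivity) _ (fun r hr => map_smul_pi_stdGaussian k l hr) hFm]
  refine lintegral_congr fun u => ?_
  have hscale : β + (∑ j, ‖u j‖ ^ 2) / 2 =
      postScale β (fun j => Matrix.toEuclideanLin Q (u j)) := by
    simp only [postScale_eq, norm_toEuclideanLin_of_transpose_mul_self hQ]
  have hFu : Measurable fun r => F r u := hFm.comp measurable_prodMk_right
  -- Writing the posterior as a dilation of the unit-scale law makes the mixing measure independent
  -- of the data.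
  rw [hscale, ← map_mul_invGamma_one (postScale_pos hβ _), lintegral_map hFu (by fun_prop)]

end JointLaw

/-! ### Posterior of the scale and prediction of the unknown. -/

section Posterior

variable {n m l k : ℕ} {Ω : Type*} [MeasurableSpace Ω]

/-- The law of the coordinates of the observations with respect to orthonormal columns. -/
noncomputable def observationLaw (k l : ℕ) (α β : ℝ) :
    Measure (Fin k → EuclideanSpace ℝ (Fin l)) :=
  volume.withDensity fun u => ENNReal.ofReal (evidence α β (k * l) (∑ j, ‖u j‖ ^ 2))

instance sFinite_observationLaw (k l : ℕ) (α β : ℝ) : SFinite (observationLaw k l α β) := by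
  unfold observationLaw
  infer_instance

theorem measurable_evidence_sum (k l : ℕ) (α β : ℝ) :
    Measurable fun u : Fin k → EuclideanSpace ℝ (Fin l) =>
      ENNReal.ofReal (evidence α β (k * l) (∑ j, ‖u j‖ ^ 2)) := by
  unfold evidence
  fun_prop

theorem isOpenPosMeasure_observationLaw (k l : ℕ) {α β : ℝ} (hα : 0 < α) (hβ : 0 < β) :
    (observationLaw k l α β).IsOpenPosMeasure := by
  refine isOpenPosMeasure_withDensity _ (measurable_evidence_sum k l α β) fun u => ?_
  rw [ne_eq, ENNReal.ofReal_eq_zero, not_le]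
  exact evidence_pos hα hβ (by positivity) (by positivity)

theorem multivariateStudent_eq_map_invGamma_one {Q : Matrix (Fin n) (Fin l) ℝ} (hQ : Qᵀ * Q = 1)
    {a b : ℝ} (ha : 0 < a) (hb : 0 < b) (μ : EuclideanSpace ℝ (Fin n)) :
    multivariateStudent (2 * a) μ ((b / a) • (Q * Qᵀ)) =
      ((invGamma a 1).prod (stdGaussian (EuclideanSpace ℝ (Fin l)))).map
        fun p => μ + √(b * p.1) • Matrix.toEuclideanLin Q p.2 := by
  have hQm := (continuous_toEuclideanLin Q).measurable
  have := isProbabilityMeasure_invGamma ha one_pos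
  have hprod : (invGamma a b).prod (stdGaussian (EuclideanSpace ℝ (Fin l))) =
      ((invGamma a 1).prod (stdGaussian (EuclideanSpace ℝ (Fin l)))).map
        (Prod.map (fun s => b * s) id) := by
    rw [← Measure.map_prod_map _ _ (by fun_prop) measurable_id, Measure.map_id,
      map_mul_invGamma_one hb]
  rw [multivariateStudent_eq_map hQ ha hb, hprod, Measure.map_map (by fun_prop) (by fun_prop)]
  rfl

/-- The posterior of the scale is inverse-gamma. -/
theorem posterior_scale (x₀ : EuclideanSpace ℝ (Fin n)) {V : Matrix (Fin n) (Fin m) ℝ}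
    {Q : Matrix (Fin n) (Fin l) ℝ} {R : Matrix (Fin n) (Fin n) ℝ} (hQ : Qᵀ * Q = 1)
    (hRV : R * V = 0) (hRQ : R * Q = Q) {α β : ℝ} (hα : 0 < α) (hβ : 0 < β)
    {P : Measure Ω} [IsProbabilityMeasure P] {s : Ω → ℝ} {x : Ω → EuclideanSpace ℝ (Fin n)}
    {X : Ω → Fin k → EuclideanSpace ℝ (Fin n)}
    (hs : Measurable s) (hx : Measurable x) (hX : Measurable X)
    (hs_law : P.map s = invGamma α β)
    (h_model : ∀ᵐ r ∂(P.map s),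
      condDistrib (fun ω => (x ω, X ω)) s P r =
        (multivariateGaussian x₀ (V * Vᵀ + r • (Q * Qᵀ))).prod
          (Measure.pi fun _ : Fin k =>
            (multivariateGaussian x₀ (V * Vᵀ + r • (Q * Qᵀ))).map
              fun v => Matrix.toEuclideanLin R (v - x₀))) :
    (∀ᵐ ξ ∂(P.map X), condDistrib s X P ξ = invGamma (α + k * l / 2) (postScale β ξ)) ∧
      ∀ u : Fin k → EuclideanSpace ℝ (Fin l),
        HasCondLawAt P s X (fun j => Matrix.toEuclideanLin Q (u j))
          (invGamma (α + k * l / 2) (postScale β fun j => Matrix.toEuclideanLin Q (u j))) := by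
  have hQc := continuous_toEuclideanLin Q
  have hprob := isProbabilityMeasure_invGamma (α := α + k * l / 2) (by positivity) one_pos
  have hopen := isOpenPosMeasure_observationLaw k l hα hβ
  have hpc := continuous_postScale (n := n) (k := k) β
  have hpm := hpc.measurable
  have hc : Continuous fun u : Fin k → EuclideanSpace ℝ (Fin l) =>
      fun j => Matrix.toEuclideanLin Q (u j) := by fun_prop
  have key := condDistrib_and_hasCondLawAt_of_lintegral (P := P) hs hX (observationLaw k l α β)
    (invGamma (α + k * l / 2) 1) hc
    (g := fun q : (Fin k → EuclideanSpace ℝ (Fin n)) × ℝ => postScale β q.1 * q.2)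
    (by fun_prop) (fun t => by fun_prop) ?_
  · simpa only [map_mul_invGamma_one (postScale_pos hβ _)] using key
  · intro f hf
    rw [lintegral_model x₀ hQ hRV hRQ hα hβ hs hx hX hs_law h_model
      (f := fun r _ ξ => f (ξ, r)) (by fun_prop), observationLaw,
      lintegral_withDensity_eq_lintegral_mul₀ (measurable_evidence_sum k l α β).aemeasurable]
    · simp
    · refine Measurable.aemeasurable (Measurable.lintegral_prod_right' (f := fun q :
        (Fin k → EuclideanSpace ℝ (Fin l)) × ℝ => f (fun j => Matrix.toEuclideanLin Q (q.1 j),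
          postScale β (fun j => Matrix.toEuclideanLin Q (q.1 j)) * q.2)) ?_)
      have := hc.measurable
      fun_prop

/-- The predictive distribution of the unknown, given the linear information `C x` that does not
see the range of `Q`, is multivariate Student. -/
theorem predictive_unknown (x₀ : EuclideanSpace ℝ (Fin n)) {V : Matrix (Fin n) (Fin m) ℝ}
    {Q : Matrix (Fin n) (Fin l) ℝ} {R : Matrix (Fin n) (Fin n) ℝ} (hQ : Qᵀ * Q = 1)
    (hRV : R * V = 0) (hRQ : R * Q = Q) {α β : ℝ} (hα : 0 < α) (hβ : 0 < β)
    {P : Measure Ω} [IsProbabilityMeasure P] {s : Ω → ℝ} {x : Ω → EuclideanSpace ℝ (Fin n)}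
    {X : Ω → Fin k → EuclideanSpace ℝ (Fin n)}
    (hs : Measurable s) (hx : Measurable x) (hX : Measurable X)
    (hs_law : P.map s = invGamma α β)
    (h_model : ∀ᵐ r ∂(P.map s),
      condDistrib (fun ω => (x ω, X ω)) s P r =
        (multivariateGaussian x₀ (V * Vᵀ + r • (Q * Qᵀ))).prod
          (Measure.pi fun _ : Fin k =>
            (multivariateGaussian x₀ (V * Vᵀ + r • (Q * Qᵀ))).map
              fun v => Matrix.toEuclideanLin R (v - x₀)))
    {C : Matrix (Fin m) (Fin n) ℝ} (hCQ : C * Q = 0)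
    (hCV : (C * V).det ≠ 0) :
    (∀ᵐ d ∂(P.map fun ω => (Matrix.toEuclideanLin C (x ω), X ω)),
      condDistrib x (fun ω => (Matrix.toEuclideanLin C (x ω), X ω)) P d =
        multivariateStudent (2 * (α + k * l / 2))
          (x₀ + Matrix.toEuclideanLin (V * (C * V)⁻¹) (d.1 - Matrix.toEuclideanLin C x₀))
          ((postScale β d.2 / (α + k * l / 2)) • (Q * Qᵀ))) ∧
      ∀ (y : EuclideanSpace ℝ (Fin m)) (u : Fin k → EuclideanSpace ℝ (Fin l)),
        HasCondLawAt P x (fun ω => (Matrix.toEuclideanLin C (x ω), X ω))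
          (y, fun j => Matrix.toEuclideanLin Q (u j))
          (multivariateStudent (2 * (α + k * l / 2))
            (x₀ + Matrix.toEuclideanLin (V * (C * V)⁻¹) (y - Matrix.toEuclideanLin C x₀))
            ((postScale β (fun j => Matrix.toEuclideanLin Q (u j)) / (α + k * l / 2)) •
              (Q * Qᵀ))) := by
  have hQc := continuous_toEuclideanLin Q
  have hVc := continuous_toEuclideanLin V
  have hCc := continuous_toEuclideanLin C
  have hLc := continuous_toEuclideanLin (V * (C * V)⁻¹)
  have hQm := hQc.measurable
  have hVm := hVc.measurable
  have hCm := hCc.measurable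
  have hLm := hLc.measurable
  have ha : 0 < α + k * l / 2 := by positivity
  have hprob := isProbabilityMeasure_invGamma ha one_pos
  have hopen := isOpenPosMeasure_observationLaw k l hα hβ
  have hpc := continuous_postScale (n := n) (k := k) β
  have hpm := hpc.measurable
  have hQQ : Continuous fun u : Fin k → EuclideanSpace ℝ (Fin l) =>
      fun j => Matrix.toEuclideanLin Q (u j) := by fun_prop
  have hQQm := hQQ.measurable
  have hshift : ∀ z, x₀ + Matrix.toEuclideanLin (V * (C * V)⁻¹)
      (Matrix.toEuclideanLin C (x₀ + Matrix.toEuclideanLin V z) - Matrix.toEuclideanLin C x₀) =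
      x₀ + Matrix.toEuclideanLin V z := by
    intro z
    rw [map_add, add_sub_cancel_left, ← toEuclideanLin_mul_apply, ← toEuclideanLin_mul_apply,
      Matrix.mul_assoc _ C V, Matrix.mul_assoc V, Matrix.nonsing_inv_mul _ hCV.isUnit,
      Matrix.mul_one]
  have hsolve : ∀ y, Matrix.toEuclideanLin C (x₀ + Matrix.toEuclideanLin V
      (Matrix.toEuclideanLin (C * V)⁻¹ (y - Matrix.toEuclideanLin C x₀))) = y := by
    intro y
    rw [map_add, ← toEuclideanLin_mul_apply C V, ← toEuclideanLin_mul_apply,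
      Matrix.mul_nonsing_inv _ hCV.isUnit, toEuclideanLin_one_apply, add_sub_cancel]
  -- The data are parametrized by the `V`-coordinates of `x - x₀` and the `Q`-coordinates of the
  -- observations. The randomness left in the fibre is the unit-scale variance and the Gaussian
  -- component along `Q`.
  have key := condDistrib_and_hasCondLawAt_of_lintegral (P := P) (Z := x)
    (D := fun ω => (Matrix.toEuclideanLin C (x ω), X ω)) hx (by fun_prop)
    ((stdGaussian (EuclideanSpace ℝ (Fin m))).prod (observationLaw k l α β))
    ((invGamma (α + k * l / 2) 1).prod (stdGaussian (EuclideanSpace ℝ (Fin l))))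
    (a := fun q => (Matrix.toEuclideanLin C (x₀ + Matrix.toEuclideanLin V q.1),
      fun j => Matrix.toEuclideanLin Q (q.2 j))) (by fun_prop)
    (g := fun q : (EuclideanSpace ℝ (Fin m) × (Fin k → EuclideanSpace ℝ (Fin n))) ×
        (ℝ × EuclideanSpace ℝ (Fin l)) =>
      (x₀ + Matrix.toEuclideanLin (V * (C * V)⁻¹) (q.1.1 - Matrix.toEuclideanLin C x₀)) +
        √(postScale β q.1.2 * q.2.1) • Matrix.toEuclideanLin Q q.2.2)
    (by fun_prop) (fun θ => by fun_prop) ?_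
  · have hst := fun ξ : Fin k → EuclideanSpace ℝ (Fin n) =>
      multivariateStudent_eq_map_invGamma_one hQ ha (postScale_pos hβ ξ)
    refine ⟨?_, fun y u => ?_⟩
    · filter_upwards [key.1] with d hd
      rw [hd, hst]
    · have := key.2 (Matrix.toEuclideanLin (C * V)⁻¹ (y - Matrix.toEuclideanLin C x₀), u)
      simp only [hsolve] at this
      rw [hst]
      exact this
  · intro f hf
    have hC0 : ∀ w, Matrix.toEuclideanLin C (Matrix.toEuclideanLin Q w) = 0 := fun w => by
      rw [← toEuclideanLin_mul_apply, hCQ]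
      simp
    have hCx : ∀ (z : EuclideanSpace ℝ (Fin m)) (c : ℝ) (w : EuclideanSpace ℝ (Fin l)),
        Matrix.toEuclideanLin C (x₀ + (Matrix.toEuclideanLin V z + c • Matrix.toEuclideanLin Q w)) =
          Matrix.toEuclideanLin C (x₀ + Matrix.toEuclideanLin V z) := fun z c w => by
      simp only [map_add, map_smul, hC0, smul_zero, add_zero]
    rw [lintegral_model x₀ hQ hRV hRQ hα hβ hs hx hX hs_law h_model
      (f := fun _ y ξ => f ((Matrix.toEuclideanLin C y, ξ), y)) (by fun_prop)]
    -- The information depends on `z` alone, and the fibre centre recomputed from it is `x₀ + V z`.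
    simp only [hCx, hshift]
    have hG : Measurable fun q : (EuclideanSpace ℝ (Fin m) × (Fin k → EuclideanSpace ℝ (Fin l))) ×
        (ℝ × EuclideanSpace ℝ (Fin l)) =>
        f ((Matrix.toEuclideanLin C (x₀ + Matrix.toEuclideanLin V q.1.1),
            fun j => Matrix.toEuclideanLin Q (q.1.2 j)),
          x₀ + Matrix.toEuclideanLin V q.1.1 +
            √(postScale β (fun j => Matrix.toEuclideanLin Q (q.1.2 j)) * q.2.1) •
              Matrix.toEuclideanLin Q q.2.2) := by fun_prop
    rw [lintegral_prod_symm' _ hG.lintegral_prod_right', observationLaw,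
      lintegral_withDensity_eq_lintegral_mul₀ (measurable_evidence_sum k l α β).aemeasurable
        hG.lintegral_prod_right'.lintegral_prod_left'.aemeasurable]
    refine lintegral_congr fun u => ?_
    simp only [Pi.mul_apply]
    congr 1
    have hGu : Measurable fun q : EuclideanSpace ℝ (Fin m) × ℝ × EuclideanSpace ℝ (Fin l) =>
        f ((Matrix.toEuclideanLin C (x₀ + Matrix.toEuclideanLin V q.1),
            fun j => Matrix.toEuclideanLin Q (u j)),
          x₀ + Matrix.toEuclideanLin V q.1 +
            √(postScale β (fun j => Matrix.toEuclideanLin Q (u j)) * q.2.1) •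
              Matrix.toEuclideanLin Q q.2.2) := by fun_prop
    have hL : ∀ t : ℝ, ∫⁻ p, f ((Matrix.toEuclideanLin C (x₀ + Matrix.toEuclideanLin V p.1),
            fun j => Matrix.toEuclideanLin Q (u j)),
          x₀ + (Matrix.toEuclideanLin V p.1 +
            √(postScale β (fun j => Matrix.toEuclideanLin Q (u j)) * t) •
              Matrix.toEuclideanLin Q p.2)) ∂((stdGaussian (EuclideanSpace ℝ (Fin m))).prod
              (stdGaussian (EuclideanSpace ℝ (Fin l)))) =
        ∫⁻ z, ∫⁻ w, f ((Matrix.toEuclideanLin C (x₀ + Matrix.toEuclideanLin V z),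
            fun j => Matrix.toEuclideanLin Q (u j)),
          x₀ + Matrix.toEuclideanLin V z +
            √(postScale β (fun j => Matrix.toEuclideanLin Q (u j)) * t) •
              Matrix.toEuclideanLin Q w) ∂(stdGaussian (EuclideanSpace ℝ (Fin l)))
              ∂(stdGaussian (EuclideanSpace ℝ (Fin m))) := by
      intro t
      rw [lintegral_prod _ (by fun_prop)]
      simp only [add_assoc]
    simp only [hL]
    -- The observed component `z` moves outside the scale `t`, to match the order data first, fibre
    -- second.
    rw [lintegral_lintegral_swap]
    · refine lintegral_congr fun z => ?_
      rw [lintegral_prod _ (by fun_prop)]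
    · refine Measurable.aemeasurable (Measurable.lintegral_prod_right' (f := fun q :
        (ℝ × EuclideanSpace ℝ (Fin m)) × EuclideanSpace ℝ (Fin l) =>
        f ((Matrix.toEuclideanLin C (x₀ + Matrix.toEuclideanLin V q.1.2),
            fun j => Matrix.toEuclideanLin Q (u j)),
          x₀ + Matrix.toEuclideanLin V q.1.2 +
            √(postScale β (fun j => Matrix.toEuclideanLin Q (u j)) * q.1.1) •
              Matrix.toEuclideanLin Q q.2)) (by fun_prop))

end Posterior

end ProjUQ

/-! ### The main theorem. -/

theorem lemma7 {n m k : ℕ}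
    (A : Matrix (Fin n) (Fin n) ℝ) (V W : Matrix (Fin n) (Fin m) ℝ)
    (Y : Matrix (Fin n) (Fin (n - m)) ℝ) (x₀ : EuclideanSpace ℝ (Fin n)) (α β : ℝ)
    (hA : A.det ≠ 0) (hV : V.rank = m) (hW : W.rank = m) (hWAV : (Wᵀ * A * V).det ≠ 0)
    (hY : LinearIndependent ℝ Y.col) (hWAY : Wᵀ * A * Y = 0)
    (hα : 0 < α) (hβ : 0 < β)
    {Ω : Type*} [MeasurableSpace Ω] (P : Measure Ω) [IsProbabilityMeasure P]
    (s : Ω → ℝ) (x : Ω → EuclideanSpace ℝ (Fin n)) (X : Ω → Fin k → EuclideanSpace ℝ (Fin n))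
    (hs : Measurable s) (hx : Measurable x) (hX : Measurable X)
    -- the prior of the scale
    (hs_law : P.map s = ProjUQ.invGamma α β)
    -- given `s = r`: `x` is normal with mean `x₀` and covariance `V Vᵀ + r P₂`, and the `k`
    -- observations are independent copies of `P₁ (x - x₀)`, independent of `x`
    (h_model : ∀ᵐ r ∂(P.map s),
      condDistrib (fun ω => (x ω, X ω)) s P r =
        (multivariateGaussian x₀ (V * Vᵀ + r • ProjUQ.projP₂ Y)).prod
          (Measure.pi fun _ : Fin k =>
            (multivariateGaussian x₀ (V * Vᵀ + r • ProjUQ.projP₂ Y)).map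
              fun v => Matrix.toEuclideanLin (ProjUQ.projP₁ A V W) (v - x₀))) :
    -- posterior of `s` given `X`: regular conditional distribution
    (∀ᵐ ξ ∂(P.map X),
      condDistrib s X P ξ =
        ProjUQ.invGamma (ProjUQ.postShape n m k α) (ProjUQ.postScale β ξ)) ∧
    -- posterior of `s` given `X = ξ`, for every single possible value `ξ` of the data
    (∀ ξ : Fin k → EuclideanSpace ℝ (Fin n),
      (∀ j, ξ j ∈ LinearMap.range (Matrix.toEuclideanLin (ProjUQ.projP₁ A V W))) →
      ProjUQ.HasCondLawAt P s X ξ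
        (ProjUQ.invGamma (ProjUQ.postShape n m k α) (ProjUQ.postScale β ξ))) ∧
    -- predictive distribution of `x` given `Wᵀ A x = Wᵀ b` and `X`: regular conditional distribution
    (∀ᵐ d ∂(P.map fun ω => (Matrix.toEuclideanLin (Wᵀ * A) (x ω), X ω)),
      ∀ b : EuclideanSpace ℝ (Fin n), Matrix.toEuclideanLin Wᵀ b = d.1 →
      condDistrib x (fun ω => (Matrix.toEuclideanLin (Wᵀ * A) (x ω), X ω)) P d =
        ProjUQ.multivariateStudent (2 * ProjUQ.postShape n m k α)
          (ProjUQ.projApprox A V W x₀ b)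
          ((ProjUQ.postScale β d.2 / ProjUQ.postShape n m k α) • ProjUQ.projP₂ Y)) ∧
    -- predictive distribution of `x` given `Wᵀ A x = Wᵀ b` and `X = ξ`, for every single `b`
    -- and every possible value `ξ` of the data
    (∀ (b : EuclideanSpace ℝ (Fin n)) (ξ : Fin k → EuclideanSpace ℝ (Fin n)),
      (∀ j, ξ j ∈ LinearMap.range (Matrix.toEuclideanLin (ProjUQ.projP₁ A V W))) →
      ProjUQ.HasCondLawAt P x (fun ω => (Matrix.toEuclideanLin (Wᵀ * A) (x ω), X ω))
        (Matrix.toEuclideanLin Wᵀ b, ξ)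
        (ProjUQ.multivariateStudent (2 * ProjUQ.postShape n m k α)
          (ProjUQ.projApprox A V W x₀ b)
          ((ProjUQ.postScale β ξ / ProjUQ.postShape n m k α) • ProjUQ.projP₂ Y))) := by
  obtain ⟨B, hQ, hQP⟩ := ProjUQ.exists_orthonormal_columns hY
  set Q := Y * B with hQdef
  -- This makes the truncated subtraction in the width of `Y` agree with the real one in
  -- `postShape`.
  have hmn : m ≤ n := by simpa [hV] using Matrix.rank_le_height V
  have hshape : ProjUQ.postShape n m k α = α + k * ((n - m : ℕ) : ℝ) / 2 := by
    rw [ProjUQ.postShape, Nat.cast_sub hmn]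
  have hWAQ : Wᵀ * A * Q = 0 := by rw [hQdef, ← Matrix.mul_assoc, hWAY, Matrix.zero_mul]
  have hcoord : ∀ ξ : Fin k → EuclideanSpace ℝ (Fin n),
      (∀ j, ξ j ∈ LinearMap.range (Matrix.toEuclideanLin (ProjUQ.projP₁ A V W))) →
      ∃ u : Fin k → EuclideanSpace ℝ (Fin (n - m)),
        ξ = fun j => Matrix.toEuclideanLin Q (u j) := by
    intro ξ hξ
    choose u hu using fun j => ProjUQ.range_projP₁_le hWAV hQ hWAQ (hξ j)
    exact ⟨u, funext fun j => (hu j).symm⟩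
  -- The approximation depends on `b` only through `Wᵀ b`, the observed quantity.
  have happrox : ∀ b, ProjUQ.projApprox A V W x₀ b =
      x₀ + Matrix.toEuclideanLin (V * (Wᵀ * A * V)⁻¹)
        (Matrix.toEuclideanLin Wᵀ b - Matrix.toEuclideanLin (Wᵀ * A) x₀) := by
    intro b
    rw [ProjUQ.projApprox, ProjUQ.toEuclideanLin_mul_apply _ Wᵀ, map_sub (Matrix.toEuclideanLin Wᵀ),
      ← ProjUQ.toEuclideanLin_mul_apply Wᵀ A]
  rw [← hQP] at h_model ⊢
  have hRV := ProjUQ.projP₁_mul_basis hWAV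
  have hRQ := ProjUQ.projP₁_mul_of_mul_eq_zero (V := V) hWAQ
  have hpost := ProjUQ.posterior_scale x₀ hQ hRV hRQ hα hβ hs hx hX hs_law h_model
  have hpred := ProjUQ.predictive_unknown x₀ hQ hRV hRQ hα hβ hs hx hX hs_law h_model hWAQ hWAV
  rw [hshape]
  refine ⟨hpost.1, fun ξ hξ => ?_, ?_, fun b ξ hξ => ?_⟩
  · obtain ⟨u, rfl⟩ := hcoord ξ hξ
    exact hpost.2 u
  · filter_upwards [hpred.1] with d hd b hb
    rw [hd, happrox, hb]
  · obtain ⟨u, rfl⟩ := hcoord ξ hξ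
    rw [happrox]
    exact hpred.2 _ u
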